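/- Let $D>0$, $r>0$, $c_1,c_2>0$, put $c=(c_1^{-1}+c_2^{-1})^{-1}$, let $h:[0,D]\to[0,\infty)$ be continuous and strictly increasing with $h(0)=0$, and let $y\in\mathbb{R}$ satisfy $-y\ge r/(4c)$. **The hitting-time game.** Let $\mathcal P$ be the set of continuous functions $[0,\infty)\to\mathbb{R}$ that start at $0$, and $\mathcal E$ the set of nondecreasing right-continuous functions $[0,\infty)\to[0,\infty)$ (a positive value at $0$ counts as a jump at time $0$). For $x\in[0,D]$, $\psi=(\psi^1,\psi^2)\in\mathcal P^2$ and $\varrho\in\mathcal E$ let $$\varphi(t)=x+yt+\psi^1(t)-\psi^2(t)-\varrho(t),\quad t\ge 0,\qquad \tau=\tau(x,\psi,\varrho)=\inf\{t\ge0:\varphi(t)=0\}\quad(\inf\emptyset=\infty).$$ An admissible strategy for $x$ is a map $\bar\alpha:\mathcal P^2\to\mathcal E$ such that * (causality) for all $\psi,\tilde\psi\in\mathcal P^2$ and $t\ge0$, if $\psi=\tilde\psi$ on $[0,t]$ then $\bar\alpha[\psi]=\bar\alpha[\tilde\psi]$ on $[0,t]$; * for every $\psi\in\mathcal P^2$,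 with $\varrho=\bar\alpha[\psi]$, one has $\varphi(t)\in[0,D]$ for all finite $t\in[0,\tau]$, i.e. until the game terminates. Let $\bar{\mathcal A}_x$ be the set of admissible strategies and $\mathcal Q[x,\bar\alpha]=\{\psi\in\mathcal P^2:\tau(x,\psi,\bar\alpha[\psi])<\infty\}$. Let $\mathbb I(T,\psi)=\int_0^T\big(c_1(\dot\psi^1)^2+c_2(\dot\psi^2)^2\big)\,ds$ if $\psi^1,\psi^2$ are absolutely continuous on $[0,T]$, and $\mathbb I(T,\psi)=+\infty$ otherwise. The value function is $$U(x)=\inf_{\bar\alpha\in\bar{\mathcal A}_x}\ \sup_{\psi\in\mathcal Q[x,\bar\alpha]}\Big\{\int_0^\tau h(\varphi(t))\,dt+r\,\varrho(\tau)-\mathbb I(\tau,\psi)\Big\},\qquad \varrho=\bar\alpha[\psi],\ \tau=\tau(x,\psi,\varrho),\qquad x\in[0,D].$$ **The Bellman equation.** Let $\mathcal L p=-\frac{1}{4c}p^2-yp$ and $\mathcal H p=p-r$ for $p\in\mathbb{R}$, and consider $$\max\{\mathcal L f'(x)-h(x),\ \mathcal H f'(x)\}=0.\tag{B}$$ For $B=(0,D)$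 or $B=(0,D]$, a continuous function $f:[0,D]\to\mathbb{R}$ is a viscosity supersolution (resp. subsolution) of (B) on $B$ if for every $x\in B$ and every $\phi\in C^1([0,D],\mathbb{R})$ such that $f-\phi$ restricted to $B$ has a global minimum (resp. maximum) at $x$, one has $\max\{\mathcal L\phi'(x)-h(x),\mathcal H\phi'(x)\}\ge 0$ (resp. $\le 0$). A function $f:[0,D]\to\mathbb{R}$ is a viscosity solution of (B) on $[0,D]$ if it is a subsolution on $(0,D)$, a supersolution on $(0,D]$ (state constraint condition at $D$), and $f(0)=0$ (Dirichlet condition at $0$). **Theorem.** The value function $U$ is finite on $[0,D]$, and it is the unique viscosity solution of (B) on $[0,D]$: $U$ is a viscosity solution, and every viscosity solution of (B) on $[0,D]$ coincides with $U$ on $[0,D]$. -/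

import Mathlib

open Set MeasureTheory
open scoped ENNReal

noncomputable section

namespace HittingGame

/-- The data of the game: buffer size `D`, drift `y`, rate constants `c₁`, `c₂`, rejection
penalty `r`, and holding cost `h` (only its values on `[0,D]` matter). -/
structure Data where
  D : ℝ
  y : ℝ
  c₁ : ℝ
  c₂ : ℝ
  r : ℝ
  h : ℝ → ℝ
  D_pos : 0 < D
  c₁_pos : 0 < c₁
  c₂_pos : 0 < c₂
  r_pos : 0 < r
  h_cont : ContinuousOn h (Icc 0 D)
  h_strictMono : StrictMonoOn h (Icc 0 D)
  h_zero : h 0 = 0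

/-- `c = (c₁⁻¹ + c₂⁻¹)⁻¹`. -/
def Data.c (G : Data) : ℝ := (G.c₁⁻¹ + G.c₂⁻¹)⁻¹

/-- Continuous real functions on `[0,∞)` that start at zero. Each of them is represented by its
extension by `0` to negative times, which is again continuous. -/
structure Path where
  toFun : ℝ → ℝ
  continuous' : Continuous toFun
  zero_of_nonpos' : ∀ t ≤ 0, toFun t = 0

instance : CoeFun Path (fun _ => ℝ → ℝ) := ⟨Path.toFun⟩

/-- Nondecreasing right-continuous (hence RCLL) functions from `[0,∞)` to `[0,∞)`. Each of them is
represented by its extension by `0` to negative times, which is again nondecreasing and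
right-continuous; a positive value at time `0` is a jump at time `0`. -/
structure Rejection where
  toFun : ℝ → ℝ
  mono' : Monotone toFun
  right_continuous' : ∀ t, ContinuousWithinAt toFun (Ici t) t
  zero_of_neg' : ∀ t < 0, toFun t = 0

instance : CoeFun Rejection (fun _ => ℝ → ℝ) := ⟨Rejection.toFun⟩

open Classical in
/-- `κ ∫₀ᵀ ψ'(s)² ds` (possibly `∞`) if `ψ` is absolutely continuous on `[0,T]`,
and `∞` otherwise. -/
def action (κ T : ℝ) (ψ : Path) : ℝ≥0∞ :=
  if AbsolutelyContinuousOnInterval ψ 0 T then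
    ENNReal.ofReal κ * ∫⁻ s in Ioc 0 T, ENNReal.ofReal ((deriv ψ s) ^ 2)
  else ∞

/-- The rate function `𝕀(T, ψ)` of a pair of paths. -/
def rate (G : Data) (T : ℝ) (ψ : Path × Path) : ℝ≥0∞ :=
  action G.c₁ T ψ.1 + action G.c₂ T ψ.2

/-- The dynamics `φ(t) = x + y t + ψ¹(t) - ψ²(t) - ϱ(t)`. -/
def dynamics (G : Data) (x : ℝ) (ψ : Path × Path) (ϱ : Rejection) (t : ℝ) : ℝ :=
  x + G.y * t + ψ.1 t - ψ.2 t - ϱ t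

/-- The hitting time `τ = inf {t ≥ 0 : φ(t) = 0}`, with `inf ∅ = ∞`. -/
def hitTime (G : Data) (x : ℝ) (ψ : Path × Path) (ϱ : Rejection) : EReal :=
  sInf ((fun t : ℝ => (t : EReal)) '' {t : ℝ | 0 ≤ t ∧ dynamics G x ψ ϱ t = 0})

/-- Causality of a map from path controls to rejection controls. -/
def IsCausal (α : Path × Path → Rejection) : Prop :=
  ∀ (ψ ψ' : Path × Path) (t : ℝ), 0 ≤ t →
    (∀ s ∈ Icc 0 t, ψ.1 s = ψ'.1 s ∧ ψ.2 s = ψ'.2 s) →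
    ∀ s ∈ Icc 0 t, α ψ s = α ψ' s

/-- The admissible strategies of the minimizing player for the initial state `x`: causal maps
under which the dynamics stays in `[0,D]` as long as the game lasts, that is at all finite times
`t ≤ τ`. -/
def admissible (G : Data) (x : ℝ) : Set (Path × Path → Rejection) :=
  {α | IsCausal α ∧ ∀ (ψ : Path × Path) (t : ℝ), 0 ≤ t → (t : EReal) ≤ hitTime G x ψ (α ψ) →
    dynamics G x ψ (α ψ) t ∈ Icc 0 G.D}

/-- The path controls for which the dynamics hits zero in finite time. -/
def hittingControls (G : Data) (x : ℝ) (α : Path × Path → Rejection) : Set (Path × Path) :=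
  {ψ | hitTime G x ψ (α ψ) < ⊤}

/-- The cost `∫₀^τ h(φ(t)) dt + r ϱ(τ) - 𝕀(τ, ψ)` (used when `τ < ∞`); it is `-∞` if
`𝕀(τ, ψ) = ∞`. -/
def cost (G : Data) (x : ℝ) (ψ : Path × Path) (ϱ : Rejection) : EReal :=
  let τ : ℝ := (hitTime G x ψ ϱ).toReal
  (((∫ t in (0 : ℝ)..τ, G.h (dynamics G x ψ ϱ t)) + G.r * ϱ τ : ℝ) : EReal)
    - ((rate G τ ψ : ℝ≥0∞) : EReal)

/-- The value function `U` of the hitting time game. -/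
def value (G : Data) (x : ℝ) : EReal :=
  ⨅ α ∈ admissible G x, ⨆ ψ ∈ hittingControls G x α, cost G x ψ (α ψ)

/-- `𝓛 p = - p² / (4c) - y p`. -/
def opL (G : Data) (p : ℝ) : ℝ := -(1 / (4 * G.c)) * p ^ 2 - G.y * p

/-- `𝓗 p = p - r`. -/
def opH (G : Data) (p : ℝ) : ℝ := p - G.r

/-- The left-hand side `max {𝓛 p - h(x), 𝓗 p}` of the Bellman equation, with `p` for `f'(x)`. -/
def bellman (G : Data) (x p : ℝ) : ℝ := max (opL G p - G.h x) (opH G p)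

/-- Viscosity subsolutions on `B ⊆ [0,D]` of the Bellman equation. The test functions are `C¹`
on the closed interval `[0,D]`, with one-sided derivatives at its end points. -/
def IsViscositySubsolution (G : Data) (B : Set ℝ) (f : ℝ → ℝ) : Prop :=
  ContinuousOn f (Icc 0 G.D) ∧
  ∀ x ∈ B, ∀ φ : ℝ → ℝ, ContDiffOn ℝ 1 φ (Icc 0 G.D) → IsMaxOn (fun z => f z - φ z) B x →
    bellman G x (derivWithin φ (Icc 0 G.D) x) ≤ 0

/-- Viscosity supersolutions on `B ⊆ [0,D]` of the Bellman equation. -/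
def IsViscositySupersolution (G : Data) (B : Set ℝ) (f : ℝ → ℝ) : Prop :=
  ContinuousOn f (Icc 0 G.D) ∧
  ∀ x ∈ B, ∀ φ : ℝ → ℝ, ContDiffOn ℝ 1 φ (Icc 0 G.D) → IsMinOn (fun z => f z - φ z) B x →
    0 ≤ bellman G x (derivWithin φ (Icc 0 G.D) x)

/-- Viscosity solutions on `[0,D]`, with the Dirichlet condition at `0` and the state constraint
condition at `D`. Only the values of `f` on `[0,D]` matter. -/
def IsViscositySolution (G : Data) (f : ℝ → ℝ) : Prop :=
  IsViscositySubsolution G (Ioo 0 G.D) f ∧ IsViscositySupersolution G (Ioc 0 G.D) f ∧ f 0 = 0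

end HittingGame

end

noncomputable section

namespace HittingGame

open Filter Topology

/-! Both the value function and every viscosity solution are computed explicitly. `opL G` is a
concave parabola vanishing at `0`, and the drift condition says exactly `0 ≤ opL G G.r`. Hence there
is a largest level `ℓ` with `h ℓ ≤ opL G G.r`. Below `ℓ` the Bellman equation selects the smaller
root of `opL G p = h z`, above `ℓ` the slope `r`; integrating from `0` gives `potential G`.

Uniqueness (`viscositySolution_unique`): a supersolution grows at least as fast as any slope at
which the Bellman expression is negative (`supersolution_growth`), a subsolution at most as fast as
any slope above which it is positive (`subsolution_growth`). Concavity gives `opL G p > h` strictly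
between the lower root and `r` below `ℓ`, so the two bounds meet.

Upper bound for the value (`cost_reflection_le`): the minimizing player reflects at `ℓ`. By the
Legendre inequality `mul_sub_le_neg_opL`, the integrated slope along the trajectory plus the
accumulated payoff has nonpositive derivative, whatever the paths.

Lower bound (`potential_le_value`): against any strategy the maximizing player steers with velocity
`p / (2c)`, the Legendre dual of a slope `p` just below the root. Since `p ≤ r`, each rejection pays
at least the potential it destroys. A state above `ℓ` is first played with `p = r`, where waiting is
profitable because `h > opL G G.r`. -/

lemma Data.c_pos (G : Data) : 0 < G.c := by
  have h₁ := G.c₁_pos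
  have h₂ := G.c₂_pos
  unfold Data.c
  positivity

/-! ### Algebra of the concave Hamiltonian -/

lemma opL_sub (G : Data) (p q : ℝ) :
    opL G q - opL G p = (q - p) * (-G.y - (p + q) / (4 * G.c)) := by
  have := G.c_pos.ne'
  unfold opL
  field_simp
  ring

lemma opL_zero (G : Data) : opL G 0 = 0 := by simp [opL]

lemma opL_lt_opL (G : Data) {p q : ℝ} (hpq : p < q) (hq : q ≤ 2 * G.c * -G.y) :
    opL G p < opL G q := by
  have hc := G.c_pos
  rw [← sub_pos, opL_sub]
  refine mul_pos (sub_pos.2 hpq) ?_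
  rw [sub_pos, div_lt_iff₀ (by positivity)]
  linarith

lemma opL_le_opL (G : Data) {p q : ℝ} (hpq : p ≤ q) (hq : q ≤ 2 * G.c * -G.y) :
    opL G p ≤ opL G q := by
  rcases hpq.eq_or_lt with rfl | h
  · rfl
  · exact (opL_lt_opL G h hq).le

/-- Concavity of `𝓛`, in the form of a chord inequality. -/
lemma opL_chord (G : Data) {a p b : ℝ} (hap : a ≤ p) (hpb : p ≤ b) :
    (b - p) * opL G a + (p - a) * opL G b ≤ (b - a) * opL G p := by
  have hc := G.c_pos
  have key : (b - a) * opL G p - ((b - p) * opL G a + (p - a) * opL G b)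
      = 1 / (4 * G.c) * ((b - p) * (p - a) * (b - a)) := by
    unfold opL
    ring
  have : 0 ≤ 1 / (4 * G.c) * ((b - p) * (p - a) * (b - a)) := by
    have h1 := sub_nonneg.2 hap
    have h2 := sub_nonneg.2 hpb
    have h3 := sub_nonneg.2 (hap.trans hpb)
    positivity
  linarith

lemma le_opL_of_mem_Icc (G : Data) {a p b u : ℝ} (hap : a ≤ p) (hpb : p ≤ b)
    (ha : u ≤ opL G a) (hb : u ≤ opL G b) : u ≤ opL G p := by
  rcases (hap.trans hpb).eq_or_lt with h | h
  · rwa [← le_antisymm hap (h ▸ hpb)]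
  · have := opL_chord G hap hpb
    have h1 := mul_le_mul_of_nonneg_left ha (sub_nonneg.2 hpb)
    have h2 := mul_le_mul_of_nonneg_left hb (sub_nonneg.2 hap)
    have h3 : (b - a) * u ≤ (b - a) * opL G p := by linarith
    exact le_of_mul_le_mul_left h3 (sub_pos.2 h)

lemma lt_opL_of_mem_Ioc (G : Data) {a p b u : ℝ} (hap : a < p) (hpb : p ≤ b)
    (ha : u ≤ opL G a) (hb : u < opL G b) : u < opL G p := by
  have := opL_chord G hap.le hpb
  have h1 := mul_le_mul_of_nonneg_left ha (sub_nonneg.2 hpb)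
  have h2 := mul_lt_mul_of_pos_left hb (sub_pos.2 hap)
  have h3 : (b - a) * u < (b - a) * opL G p := by linarith
  exact lt_of_mul_lt_mul_left h3 (by linarith)

/-- Completing the square at the vertex `-2cy`. It makes the root real for every `u` in the range of
`opL G`, in particular for `u ≤ opL G G.r`. -/
lemma opL_le_max (G : Data) (p : ℝ) : opL G p ≤ G.c * G.y ^ 2 := by
  have hc := G.c_pos
  have : G.c * G.y ^ 2 - opL G p = 1 / (4 * G.c) * (p + 2 * G.c * G.y) ^ 2 := by
    unfold opL
    field_simp
    ring
  have h2 : 0 ≤ 1 / (4 * G.c) * (p + 2 * G.c * G.y) ^ 2 := by positivity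
  linarith

lemma continuous_opL (G : Data) : Continuous (opL G) := by
  unfold opL
  fun_prop

/-- The drift condition of the theorem. -/
lemma opL_r_nonneg {G : Data} (hy : G.r / (4 * G.c) ≤ -G.y) : 0 ≤ opL G G.r := by
  have h := opL_sub G 0 G.r
  rw [opL_zero, sub_zero, sub_zero, zero_add] at h
  rw [h]
  exact mul_nonneg G.r_pos.le (sub_nonneg.2 hy)

lemma neg_y_pos {G : Data} (hy : G.r / (4 * G.c) ≤ -G.y) : 0 < -G.y :=
  (div_pos G.r_pos (by linarith [G.c_pos])).trans_le hy

/-- The smaller root `p` of `𝓛 p = u`. -/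
def lowerRoot (G : Data) (u : ℝ) : ℝ := 2 * G.c * (-G.y - √(G.y ^ 2 - u / G.c))

lemma continuous_lowerRoot (G : Data) : Continuous (lowerRoot G) := by
  unfold lowerRoot
  fun_prop

lemma lowerRoot_le (G : Data) (u : ℝ) : lowerRoot G u ≤ 2 * G.c * -G.y := by
  have hc := G.c_pos
  unfold lowerRoot
  gcongr
  linarith [Real.sqrt_nonneg (G.y ^ 2 - u / G.c)]

lemma lowerRoot_mono (G : Data) : Monotone (lowerRoot G) := by
  have hc := G.c_pos
  intro u v huv
  unfold lowerRoot
  gcongr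

lemma opL_lowerRoot (G : Data) {u : ℝ} (hu : u ≤ G.c * G.y ^ 2) : opL G (lowerRoot G u) = u := by
  have hc := G.c_pos
  have h0 : 0 ≤ G.y ^ 2 - u / G.c := by
    rw [sub_nonneg, div_le_iff₀ hc]
    linarith
  have hs := Real.sq_sqrt h0
  have e : opL G (lowerRoot G u) = G.c * (G.y ^ 2 - (√(G.y ^ 2 - u / G.c)) ^ 2) := by
    unfold opL lowerRoot
    field_simp
    ring
  rw [e, hs]
  field_simp
  ring

lemma lowerRoot_zero {G : Data} (hy : 0 < -G.y) : lowerRoot G 0 = 0 := by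
  have : √(G.y ^ 2) = -G.y := by
    rw [Real.sqrt_sq_eq_abs, abs_of_neg (by linarith)]
  simp [lowerRoot, this]

/-- The level above which the minimizing player rejects. -/
def Data.level (G : Data) : ℝ := sSup {z | z ∈ Icc 0 G.D ∧ G.h z ≤ opL G G.r}

/-- The nearest point of `[0, level]`. -/
def Data.clamp (G : Data) (x : ℝ) : ℝ := max 0 (min x G.level)

/-! ### The candidate value function -/

section

variable {G : Data}

lemma level_mem_set (hL : 0 ≤ opL G G.r) :
    G.level ∈ {z | z ∈ Icc 0 G.D ∧ G.h z ≤ opL G G.r} := by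
  refine IsCompact.sSup_mem ?_ ⟨0, ⟨le_rfl, G.D_pos.le⟩, by rwa [G.h_zero]⟩
  have := G.h_cont.preimage_isClosed_of_isClosed isClosed_Icc (isClosed_Iic (a := opL G G.r))
  exact isCompact_Icc.of_isClosed_subset this inter_subset_left

lemma level_mem (hL : 0 ≤ opL G G.r) : G.level ∈ Icc 0 G.D := (level_mem_set hL).1

lemma h_le_opL (hL : 0 ≤ opL G G.r) {z : ℝ} (h0 : 0 ≤ z) (hz : z ≤ G.level) :
    G.h z ≤ opL G G.r :=
  (G.h_strictMono.monotoneOn ⟨h0, hz.trans (level_mem hL).2⟩ (level_mem hL) hz).trans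
    (level_mem_set hL).2

lemma opL_lt_h (hL : 0 ≤ opL G G.r) {z : ℝ} (hz : G.level < z) (hD : z ≤ G.D) :
    opL G G.r < G.h z := by
  by_contra! h
  refine hz.not_ge (le_csSup ⟨G.D, fun w hw => hw.1.2⟩ ⟨⟨(level_mem hL).1.trans hz.le, hD⟩, h⟩)

lemma clamp_mem (hL : 0 ≤ opL G G.r) (x : ℝ) : G.clamp x ∈ Icc 0 G.level :=
  ⟨le_max_left _ _, max_le (level_mem hL).1 (min_le_right _ _)⟩

lemma clamp_mem_Icc (hL : 0 ≤ opL G G.r) (x : ℝ) : G.clamp x ∈ Icc 0 G.D :=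
  ⟨(clamp_mem hL x).1, (clamp_mem hL x).2.trans (level_mem hL).2⟩

lemma clamp_of_mem {x : ℝ} (h0 : 0 ≤ x) (hx : x ≤ G.level) : G.clamp x = x := by
  rw [Data.clamp, min_eq_left hx, max_eq_right h0]

lemma clamp_le {x : ℝ} (h0 : 0 ≤ x) : G.clamp x ≤ x := max_le h0 (min_le_left _ _)

lemma clamp_mono : Monotone G.clamp := fun _ _ h => max_le_max_left _ (min_le_min_right _ h)

/-- The slope of the value function below the level, extended by constants. -/
def valueSlope (G : Data) (x : ℝ) : ℝ := lowerRoot G (G.h (G.clamp x))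

lemma continuous_valueSlope (hL : 0 ≤ opL G G.r) : Continuous (valueSlope G) := by
  refine (continuous_lowerRoot G).comp (G.h_cont.comp_continuous ?_ (clamp_mem_Icc hL))
  unfold Data.clamp
  fun_prop

lemma opL_valueSlope (hL : 0 ≤ opL G G.r) (x : ℝ) : opL G (valueSlope G x) = G.h (G.clamp x) :=
  opL_lowerRoot G ((h_le_opL hL (clamp_mem hL x).1 (clamp_mem hL x).2).trans (opL_le_max G _))

lemma valueSlope_le (x : ℝ) : valueSlope G x ≤ 2 * G.c * -G.y := lowerRoot_le G _

lemma valueSlope_mono (hL : 0 ≤ opL G G.r) : Monotone (valueSlope G) := fun _ _ h =>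
  lowerRoot_mono G (G.h_strictMono.monotoneOn (clamp_mem_Icc hL _) (clamp_mem_Icc hL _)
    (clamp_mono h))

lemma h_nonneg {z : ℝ} (hz : z ∈ Icc 0 G.D) : 0 ≤ G.h z := by
  rw [← G.h_zero]
  exact G.h_strictMono.monotoneOn ⟨le_rfl, G.D_pos.le⟩ hz hz.1

lemma valueSlope_nonneg (hy : G.r / (4 * G.c) ≤ -G.y) (x : ℝ) : 0 ≤ valueSlope G x := by
  rw [← lowerRoot_zero (neg_y_pos hy)]
  exact lowerRoot_mono G (h_nonneg (clamp_mem_Icc (opL_r_nonneg hy) x))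

/-- The lower root lies on the increasing branch of `opL G`. If it exceeded `r`, then `opL G G.r`
would be smaller than the holding cost at a point of `[0, level]`. This also covers an `r` beyond
the vertex. -/
lemma valueSlope_le_r (hL : 0 ≤ opL G G.r) (x : ℝ) : valueSlope G x ≤ G.r := by
  by_contra! h
  have := opL_lt_opL G h (valueSlope_le x)
  rw [opL_valueSlope hL] at this
  exact this.not_ge (h_le_opL hL (clamp_mem hL x).1 (clamp_mem hL x).2)

/-- The integral of the slope. -/
def slopeInt (G : Data) (x : ℝ) : ℝ := ∫ z in (0 : ℝ)..x, valueSlope G z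

/-- The candidate for the value function. -/
def potential (G : Data) (x : ℝ) : ℝ := slopeInt G (min x G.level) + G.r * max (x - G.level) 0

lemma hasDerivAt_slopeInt (hL : 0 ≤ opL G G.r) (x : ℝ) :
    HasDerivAt (slopeInt G) (valueSlope G x) x :=
  ((continuous_valueSlope hL).integral_hasStrictDerivAt 0 x).hasDerivAt

lemma slopeInt_sub (hL : 0 ≤ opL G G.r) (a b : ℝ) :
    slopeInt G b - slopeInt G a = ∫ z in a..b, valueSlope G z :=
  intervalIntegral.integral_interval_sub_left ((continuous_valueSlope hL).intervalIntegrable _ _)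
    ((continuous_valueSlope hL).intervalIntegrable _ _)

lemma continuous_slopeInt (hL : 0 ≤ opL G G.r) : Continuous (slopeInt G) :=
  continuous_iff_continuousAt.2 fun x => (hasDerivAt_slopeInt hL x).continuousAt

lemma slopeInt_zero : slopeInt G 0 = 0 := by simp [slopeInt]

lemma continuous_potential (hL : 0 ≤ opL G G.r) : Continuous (potential G) := by
  have := continuous_slopeInt hL
  unfold potential
  fun_prop

lemma potential_of_le {x : ℝ} (hx : x ≤ G.level) : potential G x = slopeInt G x := by
  rw [potential, min_eq_left hx, max_eq_right (by linarith), mul_zero, add_zero]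

lemma potential_of_ge {x : ℝ} (hx : G.level ≤ x) :
    potential G x = slopeInt G G.level + G.r * (x - G.level) := by
  rw [potential, min_eq_right hx, max_eq_left (by linarith)]

lemma potential_zero (hL : 0 ≤ opL G G.r) : potential G 0 = 0 := by
  rw [potential_of_le (level_mem hL).1, slopeInt_zero]

end

/-! ### The candidate is a viscosity solution -/

lemma nonpos_of_hasDerivWithinAt_Iio {g : ℝ → ℝ} {q x : ℝ} (hg : HasDerivWithinAt g q (Iio x) x)
    (hmin : ∀ᶠ z in 𝓝[<] x, g x ≤ g z) : q ≤ 0 := by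
  have ht := (hasDerivWithinAt_iff_tendsto_slope' (notMem_Iio.2 le_rfl)).1 hg
  refine le_of_tendsto ht ?_
  filter_upwards [hmin, self_mem_nhdsWithin] with z hz hzx
  rw [slope_def_field]
  exact div_nonpos_of_nonneg_of_nonpos (sub_nonneg.2 hz) (sub_nonpos.2 (le_of_lt hzx))

lemma nonneg_of_hasDerivWithinAt_Ioi {g : ℝ → ℝ} {q x : ℝ} (hg : HasDerivWithinAt g q (Ioi x) x)
    (hmin : ∀ᶠ z in 𝓝[>] x, g x ≤ g z) : 0 ≤ q := by
  have ht := (hasDerivWithinAt_iff_tendsto_slope' (notMem_Ioi.2 le_rfl)).1 hg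
  refine ge_of_tendsto ht ?_
  filter_upwards [hmin, self_mem_nhdsWithin] with z hz hzx
  rw [slope_def_field]
  exact div_nonneg (sub_nonneg.2 hz) (sub_nonneg.2 (le_of_lt hzx))

section

variable {G : Data}

lemma hasDerivWithinAt_test {φ : ℝ → ℝ} (hφ : ContDiffOn ℝ 1 φ (Icc 0 G.D)) {x : ℝ}
    (hx : x ∈ Icc 0 G.D) :
    HasDerivWithinAt φ (derivWithin φ (Icc 0 G.D) x) (Icc 0 G.D) x :=
  (hφ.differentiableOn (by norm_num) x hx).hasDerivWithinAt

lemma hasDerivWithinAt_test_Iio {φ : ℝ → ℝ} (hφ : ContDiffOn ℝ 1 φ (Icc 0 G.D)) {x : ℝ}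
    (hx : x ∈ Ioc 0 G.D) :
    HasDerivWithinAt φ (derivWithin φ (Icc 0 G.D) x) (Iio x) x := by
  refine (hasDerivWithinAt_test hφ (Ioc_subset_Icc_self hx)).mono_of_mem_nhdsWithin ?_
  filter_upwards [self_mem_nhdsWithin, mem_nhdsWithin_of_mem_nhds (lt_mem_nhds hx.1)] with z h1 h2
  exact ⟨h2.le, (le_of_lt h1).trans hx.2⟩

lemma hasDerivWithinAt_test_Ioi {φ : ℝ → ℝ} (hφ : ContDiffOn ℝ 1 φ (Icc 0 G.D)) {x : ℝ}
    (hx : x ∈ Ico 0 G.D) :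
    HasDerivWithinAt φ (derivWithin φ (Icc 0 G.D) x) (Ioi x) x := by
  refine (hasDerivWithinAt_test hφ (Ico_subset_Icc_self hx)).mono_of_mem_nhdsWithin ?_
  filter_upwards [self_mem_nhdsWithin, mem_nhdsWithin_of_mem_nhds (gt_mem_nhds hx.2)] with z h1 h2
  exact ⟨hx.1.trans (le_of_lt h1), h2.le⟩

lemma hasDerivWithinAt_potential_Iio (hL : 0 ≤ opL G G.r) {x : ℝ} (hx : x ≤ G.level) :
    HasDerivWithinAt (potential G) (valueSlope G x) (Iio x) x :=
  (hasDerivAt_slopeInt hL x).hasDerivWithinAt.congr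
    (fun _ hz => potential_of_le ((le_of_lt hz).trans hx)) (potential_of_le hx)

lemma hasDerivAt_potential_of_lt {x : ℝ} (hx : G.level < x) :
    HasDerivAt (potential G) G.r x := by
  have h : HasDerivAt (fun z => slopeInt G G.level + G.r * (z - G.level)) G.r x := by
    simpa using (((hasDerivAt_id x).sub_const G.level).const_mul G.r).const_add
      (slopeInt G G.level)
  refine h.congr_of_eventuallyEq ?_
  filter_upwards [lt_mem_nhds hx] with z hz using potential_of_ge hz.le

lemma le_h_of_le_level (hL : 0 ≤ opL G G.r) {x p : ℝ} (hx : x ∈ Icc 0 G.D)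
    (hp : p ≤ valueSlope G x) : opL G p ≤ G.h x := by
  refine (opL_le_opL G hp (valueSlope_le x)).trans ?_
  rw [opL_valueSlope hL]
  exact G.h_strictMono.monotoneOn (clamp_mem_Icc hL x) hx (clamp_le hx.1)

/-- Only left derivatives are compared, so the end point `D` needs no separate treatment. Below the
level a test slope is at least the lower root: either it is at least `r`, or it lies between two
points where `opL G ≥ h` and concavity applies. -/
lemma potential_supersolution (hL : 0 ≤ opL G G.r) :
    IsViscositySupersolution G (Ioc 0 G.D) (potential G) := by
  refine ⟨(continuous_potential hL).continuousOn, fun x hx φ hφ hmin => ?_⟩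
  set p := derivWithin φ (Icc 0 G.D) x
  have hφ' := hasDerivWithinAt_test_Iio hφ hx
  have hev : ∀ᶠ z in 𝓝[<] x, potential G x - φ x ≤ potential G z - φ z := by
    filter_upwards [self_mem_nhdsWithin, mem_nhdsWithin_of_mem_nhds (lt_mem_nhds hx.1)]
      with z h1 h2
    exact hmin ⟨h2, (le_of_lt h1).trans hx.2⟩
  unfold bellman
  rcases le_or_gt x G.level with hxl | hxl
  · have h := nonpos_of_hasDerivWithinAt_Iio
      ((hasDerivWithinAt_potential_Iio hL hxl).sub hφ') hev
    rcases le_total G.r p with hr | hr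
    · exact le_max_of_le_right (sub_nonneg.2 hr)
    · refine le_max_of_le_left (sub_nonneg.2 ?_)
      refine le_opL_of_mem_Icc G (sub_nonpos.1 h) hr ?_ (h_le_opL hL hx.1.le hxl)
      rw [opL_valueSlope hL, clamp_of_mem hx.1.le hxl]
  · have h := nonpos_of_hasDerivWithinAt_Iio
      ((hasDerivAt_potential_of_lt hxl).hasDerivWithinAt.sub hφ') hev
    exact le_max_of_le_right (by unfold opH; linarith)

lemma potential_subsolution (hL : 0 ≤ opL G G.r) :
    IsViscositySubsolution G (Ioo 0 G.D) (potential G) := by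
  refine ⟨(continuous_potential hL).continuousOn, fun x hx φ hφ hmax => ?_⟩
  set p := derivWithin φ (Icc 0 G.D) x
  have hφl := hasDerivWithinAt_test_Iio hφ (Ioo_subset_Ioc_self hx)
  have hφr := hasDerivWithinAt_test_Ioi hφ (Ioo_subset_Ico_self hx)
  have hev : ∀ᶠ z in 𝓝 x, φ x - potential G x ≤ φ z - potential G z := by
    filter_upwards [lt_mem_nhds hx.1, gt_mem_nhds hx.2] with z h1 h2
    have : potential G z - φ z ≤ potential G x - φ x := hmax ⟨h1, h2⟩
    linarith
  unfold bellman
  rcases le_or_gt x G.level with hxl | hxl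
  · have h := sub_nonpos.1 (nonpos_of_hasDerivWithinAt_Iio
      (hφl.sub (hasDerivWithinAt_potential_Iio hL hxl)) (nhdsWithin_le_nhds hev))
    exact max_le (sub_nonpos.2 (le_h_of_le_level hL (Ioo_subset_Icc_self hx) h))
      (sub_nonpos.2 (h.trans (valueSlope_le_r hL x)))
  · have hd := hasDerivAt_potential_of_lt hxl
    have h := nonpos_of_hasDerivWithinAt_Iio
      (hφl.sub hd.hasDerivWithinAt) (nhdsWithin_le_nhds hev)
    have h' := nonneg_of_hasDerivWithinAt_Ioi
      (hφr.sub hd.hasDerivWithinAt) (nhdsWithin_le_nhds hev)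
    have hp : p = G.r := by linarith
    rw [hp]
    exact max_le (sub_nonpos.2 (opL_lt_h hL hxl hx.2.le).le) (by simp [opH])

lemma potential_isViscositySolution (hL : 0 ≤ opL G G.r) :
    IsViscositySolution G (potential G) :=
  ⟨potential_subsolution hL, potential_supersolution hL, potential_zero hL⟩

/-- Being a viscosity solution depends only on the values on `[0,D]`. -/
lemma IsViscositySolution.congr {f g : ℝ → ℝ} (hf : IsViscositySolution G f)
    (hfg : ∀ x ∈ Icc 0 G.D, g x = f x) : IsViscositySolution G g := by
  obtain ⟨⟨hc, hsub⟩, ⟨-, hsup⟩, h0⟩ := hf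
  refine ⟨⟨hc.congr hfg, fun x hx φ hφ hm => hsub x hx φ hφ fun z hz => ?_⟩,
    ⟨hc.congr hfg, fun x hx φ hφ hm => hsup x hx φ hφ fun z hz => ?_⟩,
    by rw [hfg 0 ⟨le_rfl, G.D_pos.le⟩, h0]⟩
  · have := hm hz
    simp only [mem_ofPred_eq] at this ⊢
    rwa [hfg x (Ioo_subset_Icc_self hx), hfg z (Ioo_subset_Icc_self hz)] at this
  · have := hm hz
    simp only [mem_ofPred_eq] at this ⊢
    rwa [hfg x (Ioc_subset_Icc_self hx), hfg z (Ioc_subset_Icc_self hz)] at this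

/-! ### Growth estimates and uniqueness -/

/-- A quadratic correction that dominates a continuous function away from a point. -/
lemma exists_quadratic_bound {w : ℝ → ℝ} {D : ℝ} (hw : ContinuousOn w (Icc 0 D)) {y δ : ℝ}
    (hy : y ∈ Icc 0 D) (hδ : 0 < δ) :
    ∃ K : ℝ, 0 ≤ K ∧ ∀ z ∈ Icc 0 D, δ ≤ |z - y| → w y ≤ w z + K * (z - y) ^ 2 := by
  obtain ⟨C, hC⟩ := isCompact_Icc.exists_bound_of_continuousOn hw
  have hC0 : 0 ≤ C := (norm_nonneg _).trans (hC y hy)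
  refine ⟨2 * C / δ ^ 2, by positivity, fun z hz h => ?_⟩
  have h1 := abs_le.1 (hC y hy)
  have h2 := abs_le.1 (hC z hz)
  have h3 : δ ^ 2 ≤ (z - y) ^ 2 := by
    rw [← sq_abs (z - y)]
    gcongr
  have h4 : 2 * C ≤ 2 * C / δ ^ 2 * (z - y) ^ 2 := by
    calc 2 * C = 2 * C / δ ^ 2 * δ ^ 2 := by field_simp
      _ ≤ _ := by gcongr
  linarith [h1.2, h2.1]

/-- The quadratic term makes a local contact at `y` global without changing the slope there. -/
lemma test_function {s : ℝ → ℝ} (hs : Continuous s) (a y K : ℝ) (hy : y ∈ Icc 0 G.D) :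
    ContDiffOn ℝ 1 (fun z => (∫ t in a..z, s t) + K * (z - y) ^ 2) (Icc 0 G.D) ∧
    derivWithin (fun z => (∫ t in a..z, s t) + K * (z - y) ^ 2) (Icc 0 G.D) y = s y := by
  have hd : ∀ x, HasDerivAt (fun z => ∫ t in a..z, s t) (s x) x := fun x =>
    (hs.integral_hasStrictDerivAt a x).hasDerivAt
  have hq : ∀ x, HasDerivAt (fun z => K * (z - y) ^ 2) (K * (2 * (x - y))) x := fun x => by
    simpa using (((hasDerivAt_id x).sub_const y).pow 2).const_mul K
  constructor
  · refine ContDiff.contDiffOn (contDiff_one_iff_deriv.2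
      ⟨fun x => ((hd x).add (hq x)).differentiableAt, ?_⟩)
    rw [show deriv (fun z => (∫ t in a..z, s t) + K * (z - y) ^ 2)
      = fun x => s x + K * (2 * (x - y)) from funext fun x => ((hd x).add (hq x)).deriv]
    fun_prop
  · have := ((hd y).add (hq y)).hasDerivWithinAt (s := Icc 0 G.D)
    exact (this.derivWithin (uniqueDiffOn_Icc G.D_pos y hy)).trans (by simp)

/-- The primitive of `s` cannot touch `u` from below at a point of `(a, D]`, so the minimum of the
difference over `[a, D]` is at `a`. The state constraint excludes a minimum at `D`. -/
lemma supersolution_growth {u : ℝ → ℝ} (hu : IsViscositySupersolution G (Ioc 0 G.D) u)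
    {s : ℝ → ℝ} (hs : Continuous s) {a : ℝ} (ha : 0 ≤ a)
    (hneg : ∀ x ∈ Ioc a G.D, bellman G x (s x) < 0) {z : ℝ} (hz : z ∈ Icc a G.D) :
    ∫ t in a..z, s t ≤ u z - u a := by
  set S : ℝ → ℝ := fun z => ∫ t in a..z, s t with hS
  have hSc : Continuous S := continuous_iff_continuousAt.2 fun x =>
    (hs.integral_hasStrictDerivAt a x).hasDerivAt.continuousAt
  have hw : ContinuousOn (fun z => u z - S z) (Icc 0 G.D) := hu.1.sub hSc.continuousOn
  obtain ⟨y, hy, hmin⟩ := isCompact_Icc.exists_isMinOn ⟨z, hz⟩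
    (hw.mono (Icc_subset_Icc_left ha))
  rcases hy.1.eq_or_lt with rfl | hay
  · have : u a - S a ≤ u z - S z := hmin hz
    have h0 : S a = 0 := by simp [hS]
    show S z ≤ _
    linarith
  · have hyD : y ∈ Icc 0 G.D := ⟨ha.trans hy.1, hy.2⟩
    obtain ⟨K, hK, hb⟩ := exists_quadratic_bound hw hyD (sub_pos.2 hay)
    obtain ⟨hφ, hφ'⟩ := test_function (G := G) hs a y (-K) hyD
    have := hu.2 y ⟨ha.trans_lt hay, hy.2⟩ _ hφ fun x hx => ?_
    · rw [hφ'] at this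
      exact absurd this (hneg y ⟨hay, hy.2⟩).not_ge
    · simp only [mem_ofPred_eq]
      have e : u y - S y ≤ u x - S x + K * (x - y) ^ 2 := by
        rcases le_total a x with hax | hax
        · have h1 : u y - S y ≤ u x - S x := hmin ⟨hax, hx.2⟩
          have h2 : 0 ≤ K * (x - y) ^ 2 := by positivity
          linarith
        · refine hb x ⟨hx.1.le, hx.2⟩ ?_
          rw [abs_sub_comm]
          exact le_trans (by linarith) (le_abs_self _)
      simp only [hS] at e
      simp
      linarith

/-- Nothing is known at `b`, which may be `D`, so an extremum there has to be prevented. The slope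
is steepened after `z`, which the hypothesis on all `p ≥ s x` allows. -/
lemma subsolution_growth {u : ℝ → ℝ} (hu : IsViscositySubsolution G (Ioo 0 G.D) u)
    {s : ℝ → ℝ} (hs : Continuous s) {a b : ℝ} (ha : 0 ≤ a) (hb : b ≤ G.D)
    (hpos : ∀ x ∈ Ioo a b, ∀ p, s x ≤ p → 0 < bellman G x p) {z : ℝ} (hz : z ∈ Ico a b) :
    u z - u a ≤ ∫ t in a..z, s t := by
  by_contra! hcon
  have hmc : Continuous fun t : ℝ => max (t - z) 0 := by fun_prop
  have hI : 0 < ∫ t in z..b, max (t - z) 0 :=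
    intervalIntegral.intervalIntegral_pos_of_pos_on (hmc.intervalIntegrable _ _)
      (fun t ht => lt_max_of_lt_left (sub_pos.2 ht.1)) hz.2
  have hI0 : ∫ t in a..z, max (t - z) 0 = 0 := by
    rw [intervalIntegral.integral_congr (g := fun _ => (0 : ℝ))]
    · simp
    · intro t ht
      rw [uIcc_of_le hz.1] at ht
      exact max_eq_right (by linarith [ht.2])
  set I := ∫ t in z..b, max (t - z) 0
  -- `κ` is large enough that `S - u` at `b` is at least its value at `a`, while `S z` is unchanged.
  -- By `hcon` the value at `z` is smaller, so the minimum is interior.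
  obtain ⟨κ, hκ, hκ'⟩ : ∃ κ : ℝ, 0 ≤ κ ∧ u b - u a - (∫ t in a..b, s t) ≤ κ * I := by
    refine ⟨|u b - u a - (∫ t in a..b, s t)| / I, by positivity, ?_⟩
    rw [div_mul_cancel₀ _ hI.ne']
    exact le_abs_self _
  set s' : ℝ → ℝ := fun t => s t + κ * max (t - z) 0 with hs'
  have hs'c : Continuous s' := by fun_prop
  set S : ℝ → ℝ := fun z => ∫ t in a..z, s' t with hS
  have hSadd : ∀ x, S x = (∫ t in a..x, s t) + κ * ∫ t in a..x, max (t - z) 0 := fun x => by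
    rw [← intervalIntegral.integral_const_mul, ← intervalIntegral.integral_add]
    · exact hs.intervalIntegrable _ _
    · exact (hmc.const_mul κ).intervalIntegrable _ _
  have hSc : Continuous S := continuous_iff_continuousAt.2 fun x =>
    (hs'c.integral_hasStrictDerivAt a x).hasDerivAt.continuousAt
  have hw : ContinuousOn (fun z => S z - u z) (Icc 0 G.D) := hSc.continuousOn.sub hu.1
  have hzI : z ∈ Icc a b := Ico_subset_Icc_self hz
  obtain ⟨y, hy, hmin⟩ := isCompact_Icc.exists_isMinOn ⟨z, hzI⟩
    (hw.mono (Icc_subset_Icc ha hb))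
  have hyz : S y - u y ≤ S z - u z := hmin hzI
  have hSz : S z = ∫ t in a..z, s t := by rw [hSadd, hI0, mul_zero, add_zero]
  have hSa : S a = 0 := by simp [hS]
  have hSb : S b = (∫ t in a..b, s t) + κ * I := by
    rw [hSadd, ← intervalIntegral.integral_add_adjacent_intervals
      (hmc.intervalIntegrable a z) (hmc.intervalIntegrable z b), hI0, zero_add]
  have hay : a < y := lt_of_le_of_ne hy.1 fun h => by
    rw [← h] at hyz
    linarith
  have hyb : y < b := lt_of_le_of_ne hy.2 fun h => by
    rw [h] at hyz
    linarith
  have hyD : y ∈ Icc 0 G.D := ⟨ha.trans hy.1, hy.2.trans hb⟩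
  obtain ⟨K, hK, hbd⟩ := exists_quadratic_bound hw hyD
    (lt_min (sub_pos.2 hay) (sub_pos.2 hyb))
  obtain ⟨hφ, hφ'⟩ := test_function (G := G) hs'c a y K hyD
  have := hu.2 y ⟨ha.trans_lt hay, hyb.trans_le hb⟩ _ hφ fun x hx => ?_
  · rw [hφ'] at this
    refine absurd this (hpos y ⟨hay, hyb⟩ _ ?_).not_ge
    have : 0 ≤ κ * max (y - z) 0 := mul_nonneg hκ (le_max_right _ _)
    simp only [hs']
    linarith
  · simp only [mem_ofPred_eq]
    have e : S y - u y ≤ S x - u x + K * (x - y) ^ 2 := by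
      by_cases hx' : x ∈ Icc a b
      · have h1 : S y - u y ≤ S x - u x := hmin hx'
        have h2 : 0 ≤ K * (x - y) ^ 2 := by positivity
        linarith
      · refine hbd x ⟨hx.1.le, hx.2.le⟩ ?_
        rcases le_total a x with hax | hax
        · have hbx : b < x := by
            by_contra! h
            exact hx' ⟨hax, h⟩
          exact (min_le_right _ _).trans (le_trans (by linarith) (le_abs_self _))
        · rw [abs_sub_comm]
          exact (min_le_left _ _).trans (le_trans (by linarith) (le_abs_self _))
    simp only [hS] at e
    simp
    linarith

/-- Raising `s` by `ε` turns the strict condition on `p` into the weak one; the end point `b`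
follows by continuity. -/
lemma subsolution_growth_Icc {u : ℝ → ℝ} (hu : IsViscositySubsolution G (Ioo 0 G.D) u)
    {s : ℝ → ℝ} (hs : Continuous s) {a b : ℝ} (ha : 0 ≤ a) (hb : b ≤ G.D)
    (hpos : ∀ x ∈ Ioo a b, ∀ p, s x < p → 0 < bellman G x p) {z : ℝ} (hz : z ∈ Icc a b) :
    u z - u a ≤ ∫ t in a..z, s t := by
  have hlt : ∀ z ∈ Ico a b, u z - u a ≤ ∫ t in a..z, s t := by
    intro z hz
    have hε : ∀ ε > 0, u z - u a ≤ (∫ t in a..z, s t) + ε * (z - a) := by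
      intro ε hε
      have := subsolution_growth hu (hs.add continuous_const) ha hb (s := fun t => s t + ε)
        (fun x hx p hp => hpos x hx p (by linarith)) hz
      rwa [intervalIntegral.integral_add (hs.intervalIntegrable _ _)
        (continuous_const.intervalIntegrable _ _), intervalIntegral.integral_const, smul_eq_mul,
        mul_comm (z - a)] at this
    have ht : Tendsto (fun ε : ℝ => (∫ t in a..z, s t) + ε * (z - a)) (𝓝[>] 0)
        (𝓝 ((∫ t in a..z, s t) + 0 * (z - a))) :=
      Tendsto.mono_left (Continuous.tendsto (by fun_prop) 0) nhdsWithin_le_nhds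
    rw [zero_mul, add_zero] at ht
    exact ge_of_tendsto ht (eventually_mem_nhdsWithin.mono fun ε hε' => hε ε hε')
  rcases hz.1.trans hz.2 |>.eq_or_lt with rfl | hab
  · obtain rfl : z = a := le_antisymm hz.2 hz.1
    simp
  · have hSc : Continuous fun z => ∫ t in a..z, s t := continuous_iff_continuousAt.2 fun x =>
      (hs.integral_hasStrictDerivAt a x).hasDerivAt.continuousAt
    have hcl : z ∈ closure (Ico a b) := by rwa [closure_Ico hab.ne]
    refine ContinuousWithinAt.closure_le hcl ?_ hSc.continuousWithinAt hlt
    have : Ico a b ⊆ Icc 0 G.D := fun x hx => ⟨ha.trans hx.1, hx.2.le.trans hb⟩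
    exact ((hu.1 z ⟨ha.trans hz.1, hz.2.trans hb⟩).mono this).sub continuousWithinAt_const

lemma slopeInt_le_of_supersolution (hL : 0 ≤ opL G G.r) {u : ℝ → ℝ}
    (hu : IsViscositySupersolution G (Ioc 0 G.D) u) {z : ℝ} (hz : z ∈ Icc 0 G.D) :
    slopeInt G z ≤ u z - u 0 := by
  have hs := continuous_valueSlope hL
  have hε : ∀ ε > 0, slopeInt G z - ε * z ≤ u z - u 0 := by
    intro ε hε
    have := supersolution_growth hu (s := fun t => valueSlope G t - ε)
      (hs.sub continuous_const) le_rfl (fun x hx => ?_) hz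
    · rwa [intervalIntegral.integral_sub (hs.intervalIntegrable _ _)
        (continuous_const.intervalIntegrable _ _), intervalIntegral.integral_const, smul_eq_mul,
        sub_zero, mul_comm z] at this
    · refine max_lt (sub_neg.2 ?_) (sub_neg.2 (by linarith [valueSlope_le_r hL x]))
      exact (opL_lt_opL G (by linarith) (valueSlope_le x)).trans_le
        (le_h_of_le_level hL (Ioc_subset_Icc_self hx) le_rfl)
  have ht : Tendsto (fun ε : ℝ => slopeInt G z - ε * z) (𝓝[>] 0) (𝓝 (slopeInt G z - 0 * z)) :=
    Tendsto.mono_left (Continuous.tendsto (by fun_prop) 0) nhdsWithin_le_nhds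
  rw [zero_mul, sub_zero] at ht
  exact le_of_tendsto ht (eventually_mem_nhdsWithin.mono fun ε hε' => hε ε hε')

/-- Strictly above the level `opL G G.r < h a`, so constant slopes `p < r` close to `r` make both
terms of the Bellman expression negative; then `p` tends to `r`. -/
lemma growth_above_level (hL : 0 ≤ opL G G.r) {u : ℝ → ℝ}
    (hu : IsViscositySupersolution G (Ioc 0 G.D) u) {a z : ℝ} (ha : G.level < a)
    (hz : z ∈ Icc a G.D) : G.r * (z - a) ≤ u z - u a := by
  have ha0 : 0 ≤ a := (level_mem hL).1.trans ha.le
  have hah := opL_lt_h hL ha (hz.1.trans hz.2)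
  have hev : ∀ᶠ p in 𝓝[<] G.r, p * (z - a) ≤ u z - u a := by
    have h1 : ∀ᶠ p in 𝓝[<] G.r, opL G p < G.h a :=
      nhdsWithin_le_nhds ((continuous_opL G).continuousAt.eventually_lt continuousAt_const hah)
    filter_upwards [h1, self_mem_nhdsWithin] with p hp hpr
    have := supersolution_growth hu (s := fun _ => p) continuous_const ha0 (fun x hx => ?_) hz
    · rwa [intervalIntegral.integral_const, smul_eq_mul, mul_comm] at this
    · refine max_lt (sub_neg.2 (hp.trans ?_)) (sub_neg.2 hpr)
      exact G.h_strictMono ⟨ha0, hz.1.trans hz.2⟩ ⟨ha0.trans hx.1.le, hx.2⟩ hx.1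
  have ht : Tendsto (fun p : ℝ => p * (z - a)) (𝓝[<] G.r) (𝓝 (G.r * (z - a))) :=
    Tendsto.mono_left (Continuous.tendsto (by fun_prop) _) nhdsWithin_le_nhds
  exact le_of_tendsto ht hev

theorem viscositySolution_unique (hL : 0 ≤ opL G G.r) {u : ℝ → ℝ}
    (hu : IsViscositySolution G u) {z : ℝ} (hz : z ∈ Icc 0 G.D) : u z = potential G z := by
  obtain ⟨hsub, hsup, h0⟩ := hu
  have hl := level_mem hL
  have hbelow : ∀ z ∈ Icc 0 G.level, u z = slopeInt G z := by
    intro z hz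
    refine le_antisymm ?_ ?_
    · have := subsolution_growth_Icc hsub (continuous_valueSlope hL) le_rfl hl.2
        (fun x hx p hp => ?_) hz
      · rwa [h0, sub_zero] at this
      -- Up to `r`, strict concavity of position forces `opL G p > h x`, since `h x < opL G G.r`
      -- strictly below the level; beyond `r` the term `opH` is positive.
      · rcases le_or_gt p G.r with hr | hr
        · refine lt_max_of_lt_left (sub_pos.2 (lt_opL_of_mem_Ioc G hp hr ?_ ?_))
          · rw [opL_valueSlope hL, clamp_of_mem hx.1.le hx.2.le]
          · exact (G.h_strictMono ⟨hx.1.le, hx.2.le.trans hl.2⟩ hl hx.2).trans_le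
              (h_le_opL hL hl.1 le_rfl)
        · exact lt_max_of_lt_right (sub_pos.2 hr)
    · have := slopeInt_le_of_supersolution hL hsup (z := z) ⟨hz.1, hz.2.trans hl.2⟩
      rwa [h0, sub_zero] at this
  rcases le_or_gt z G.level with hzl | hzl
  · rw [hbelow z ⟨hz.1, hzl⟩, potential_of_le hzl]
  · rw [potential_of_ge hzl.le, ← hbelow _ ⟨hl.1, le_rfl⟩]
    refine le_antisymm ?_ ?_
    · have := subsolution_growth_Icc hsub (s := fun _ => G.r) continuous_const hl.1 le_rfl
        (fun x hx p hp => lt_max_of_lt_right (sub_pos.2 hp)) (z := z) ⟨hzl.le, hz.2⟩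
      rw [intervalIntegral.integral_const, smul_eq_mul] at this
      linarith
    · have hcl : G.level ∈ closure (Ioo G.level z) := by
        rw [closure_Ioo hzl.ne]
        exact ⟨le_rfl, hzl.le⟩
      have hle : ∀ a ∈ Ioo G.level z, u a + G.r * (z - a) ≤ u z := fun a ha => by
        linarith [growth_above_level hL hsup ha.1 (z := z) ⟨ha.2.le, hz.2⟩]
      refine ContinuousWithinAt.closure_le (f := fun a => u a + G.r * (z - a)) hcl ?_
        continuousWithinAt_const hle
      refine ((hsub.1 _ hl).mono fun x hx => ⟨hl.1.trans hx.1.le, hx.2.le.trans hz.2⟩).add ?_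
      exact Continuous.continuousWithinAt (by fun_prop)

end

/-- A right-continuous function attains the first hitting time of a closed set. -/
lemma exists_first_hit {f : ℝ → ℝ} (hf : ∀ t, ContinuousWithinAt f (Ici t) t) {A : Set ℝ}
    (hA : IsClosed A) {t₀ t₁ : ℝ} (h₁ : t₀ ≤ t₁) (hA₁ : f t₁ ∈ A) :
    ∃ σ, t₀ ≤ σ ∧ σ ≤ t₁ ∧ f σ ∈ A ∧ ∀ t ∈ Ico t₀ σ, f t ∉ A := by
  set S : Set ℝ := {t | t₀ ≤ t ∧ f t ∈ A}
  have hbdd : BddBelow S := ⟨t₀, fun t ht => ht.1⟩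
  have hne : S.Nonempty := ⟨t₁, h₁, hA₁⟩
  refine ⟨sInf S, le_csInf hne fun t ht => ht.1, csInf_le hbdd ⟨h₁, hA₁⟩, ?_, fun t ht htA => ?_⟩
  · have hsub : S ⊆ Ici (sInf S) := fun t ht => csInf_le hbdd ht
    have := ((hf (sInf S)).mono hsub).mem_closure (csInf_mem_closure hne hbdd)
      (fun t ht => ht.2 : MapsTo f S A)
    rwa [hA.closure_eq] at this
  · exact ht.2.not_ge (csInf_le hbdd ⟨ht.1, htA⟩)

/-! ### Hitting times, rates and the Legendre bound -/

section hitTime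

variable {G : Data} {x : ℝ} {ψ : Path × Path} {ϱ : Rejection}

lemma dynamics_rightContinuous (t : ℝ) :
    ContinuousWithinAt (dynamics G x ψ ϱ) (Ici t) t := by
  have h1 := ψ.1.continuous'
  have h2 := ψ.2.continuous'
  have : Continuous fun t => x + G.y * t + ψ.1 t - ψ.2 t := by fun_prop
  exact this.continuousWithinAt.sub (ϱ.right_continuous' t)

lemma le_hitTime_iff {t : ℝ} : (t : EReal) ≤ hitTime G x ψ ϱ ↔
    ∀ s ∈ Ico 0 t, dynamics G x ψ ϱ s ≠ 0 := by
  constructor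
  · intro h s hs h0
    have : hitTime G x ψ ϱ ≤ (s : EReal) := sInf_le ⟨s, ⟨hs.1, h0⟩, rfl⟩
    exact hs.2.not_ge (EReal.coe_le_coe_iff.1 (h.trans this))
  · rintro h
    refine le_sInf ?_
    rintro _ ⟨s, ⟨hs, h0⟩, rfl⟩
    by_contra! hlt
    exact h s ⟨hs, EReal.coe_lt_coe_iff.1 hlt⟩ h0

lemma hitTime_eq {t : ℝ} (ht : 0 ≤ t) (h0 : dynamics G x ψ ϱ t = 0)
    (h : ∀ s ∈ Ico 0 t, dynamics G x ψ ϱ s ≠ 0) : hitTime G x ψ ϱ = t :=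
  le_antisymm (sInf_le ⟨t, ⟨ht, h0⟩, rfl⟩) (le_hitTime_iff.2 h)

lemma exists_hitTime_eq (h : hitTime G x ψ ϱ < ⊤) :
    ∃ τ : ℝ, 0 ≤ τ ∧ hitTime G x ψ ϱ = τ ∧ dynamics G x ψ ϱ τ = 0 := by
  obtain ⟨_, ⟨t, ⟨ht, ht0⟩, rfl⟩, -⟩ := sInf_lt_iff.1 h
  obtain ⟨σ, hσ, -, hσ0, hlt⟩ := exists_first_hit (f := dynamics G x ψ ϱ)
    dynamics_rightContinuous isClosed_singleton ht ht0
  exact ⟨σ, hσ, hitTime_eq hσ hσ0 hlt, hσ0⟩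

end hitTime

lemma action_eq_ofReal {κ T : ℝ} (hκ : 0 ≤ κ) (hT : 0 ≤ T) {ψ : Path}
    (hac : AbsolutelyContinuousOnInterval ψ 0 T)
    (hint : IntervalIntegrable (fun s => (deriv ψ s) ^ 2) volume 0 T) :
    action κ T ψ = ENNReal.ofReal (κ * ∫ s in (0 : ℝ)..T, (deriv ψ s) ^ 2) := by
  rw [action, if_pos hac, ENNReal.ofReal_mul hκ, intervalIntegral.integral_of_le hT,
    ofReal_integral_eq_lintegral_ofReal ((intervalIntegrable_iff_integrableOn_Ioc_of_le hT).1 hint)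
      (Eventually.of_forall fun s => sq_nonneg _)]

lemma of_action_ne_top {κ T : ℝ} (hκ : 0 < κ) (hT : 0 ≤ T) {ψ : Path}
    (h : action κ T ψ ≠ ∞) : AbsolutelyContinuousOnInterval ψ 0 T ∧
      IntervalIntegrable (fun s => (deriv ψ s) ^ 2) volume 0 T := by
  unfold action at h
  split_ifs at h with hac
  · refine ⟨hac, (intervalIntegrable_iff_integrableOn_Ioc_of_le hT).2 ⟨?_, ?_⟩⟩
    · exact ((measurable_deriv _).pow_const 2).aestronglyMeasurable
    · rw [hasFiniteIntegral_iff_ofReal (Eventually.of_forall fun s => sq_nonneg _)]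
      refine lt_top_iff_ne_top.2 fun htop => h ?_
      rw [htop, ENNReal.mul_top (by simpa using hκ)]
  · exact absurd rfl h

lemma cost_eq {G : Data} {x τ E : ℝ} {ψ : Path × Path} {ϱ : Rejection}
    (hτ : hitTime G x ψ ϱ = τ) (hE : 0 ≤ E) (hr : rate G τ ψ = ENNReal.ofReal E) :
    cost G x ψ ϱ
      = (((∫ t in (0 : ℝ)..τ, G.h (dynamics G x ψ ϱ t)) + G.r * ϱ τ - E : ℝ) : EReal) := by
  rw [cost, hτ]
  simp only [EReal.toReal_coe, hr, EReal.coe_ennreal_ofReal, max_eq_left hE]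
  rw [← EReal.coe_sub]

/-- The part of the Legendre transform needed: a bound for the Hamiltonian. -/
lemma mul_sub_le_neg_opL (G : Data) (p a b : ℝ) :
    p * (G.y + (a - b)) - (G.c₁ * a ^ 2 + G.c₂ * b ^ 2) ≤ -opL G p := by
  have h₁ := G.c₁_pos
  have h₂ := G.c₂_pos
  have hc := G.c_pos
  have e : G.c = G.c₁ * G.c₂ / (G.c₁ + G.c₂) := by
    unfold Data.c
    field_simp
    ring
  have k1 : G.c * (a - b) ^ 2 ≤ G.c₁ * a ^ 2 + G.c₂ * b ^ 2 := by
    rw [e, div_mul_eq_mul_div, div_le_iff₀ (by positivity)]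
    nlinarith [sq_nonneg (G.c₁ * a + G.c₂ * b)]
  have k2 : p * (a - b) - G.c * (a - b) ^ 2
      = 1 / (4 * G.c) * p ^ 2 - G.c * (a - b - p / (2 * G.c)) ^ 2 := by
    field_simp
    ring
  have k3 : 0 ≤ G.c * (a - b - p / (2 * G.c)) ^ 2 := by positivity
  unfold opL
  linarith

/-! ### Running maxima and reflection -/

/-- The running maximum over `[0,t]` of `w`. -/
def runningMax (w : ℝ → ℝ) (t : ℝ) : ℝ := sSup ((fun u => w (u * t)) '' Icc 0 1)

/-- Rescaling time makes this a supremum over the fixed compact set `[0,1]`. -/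
lemma continuous_runningMax {w : ℝ → ℝ} (hw : Continuous w) : Continuous (runningMax w) :=
  isCompact_Icc.continuous_sSup (f := fun t u => w (u * t)) (by fun_prop)

lemma image_mul_Icc (w : ℝ → ℝ) {t : ℝ} (ht : 0 ≤ t) :
    (fun u => w (u * t)) '' Icc 0 1 = w '' Icc 0 t := by
  ext v
  constructor
  · rintro ⟨u, hu, rfl⟩
    exact ⟨u * t, ⟨mul_nonneg hu.1 ht, mul_le_of_le_one_left ht hu.2⟩, rfl⟩
  · rintro ⟨s, hs, rfl⟩
    rcases ht.eq_or_lt with rfl | ht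
    · obtain rfl : s = 0 := le_antisymm hs.2 hs.1
      exact ⟨0, by simp, by simp⟩
    · exact ⟨s / t, ⟨div_nonneg hs.1 ht.le, div_le_one_of_le₀ hs.2 ht.le⟩, by
        simp [div_mul_cancel₀ _ ht.ne']⟩

lemma le_runningMax {w : ℝ → ℝ} (hw : Continuous w) {s t : ℝ} (hs : 0 ≤ s) (hst : s ≤ t) :
    w s ≤ runningMax w t := by
  rw [runningMax, image_mul_Icc w (hs.trans hst)]
  exact le_csSup (isCompact_Icc.image hw).bddAbove ⟨s, ⟨hs, hst⟩, rfl⟩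

lemma exists_eq_runningMax {w : ℝ → ℝ} (hw : Continuous w) {t : ℝ} (ht : 0 ≤ t) :
    ∃ s ∈ Icc 0 t, runningMax w t = w s := by
  rw [runningMax, image_mul_Icc w ht]
  obtain ⟨s, hs, e⟩ := (isCompact_Icc.image hw).sSup_mem ⟨w 0, 0, ⟨le_rfl, ht⟩, rfl⟩
  exact ⟨s, hs, e.symm⟩

lemma runningMax_mono {w : ℝ → ℝ} (hw : Continuous w) {s t : ℝ} (hs : 0 ≤ s) (hst : s ≤ t) :
    runningMax w s ≤ runningMax w t := by
  obtain ⟨a, ha, e⟩ := exists_eq_runningMax hw hs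
  rw [e]
  exact le_runningMax hw ha.1 (ha.2.trans hst)

lemma runningMax_congr {w w' : ℝ → ℝ} {t : ℝ} (ht : 0 ≤ t) (h : EqOn w w' (Icc 0 t)) :
    runningMax w t = runningMax w' t := by
  rw [runningMax, runningMax, image_mul_Icc w ht, image_mul_Icc w' ht, h.image_eq]

/-- A function whose increments are dominated by those of an absolutely continuous one. -/
lemma absolutelyContinuousOnInterval_of_dist_le {f g : ℝ → ℝ} {a b K : ℝ}
    (hg : AbsolutelyContinuousOnInterval g a b)
    (hfg : ∀ s ∈ uIcc a b, ∀ t ∈ uIcc a b, dist (f s) (f t) ≤ K * dist (g s) (g t)) :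
    AbsolutelyContinuousOnInterval f a b := by
  unfold AbsolutelyContinuousOnInterval at *
  have h0 := Tendsto.const_mul K hg
  rw [mul_zero] at h0
  refine tendsto_of_tendsto_of_tendsto_of_le_of_le' tendsto_const_nhds h0
    (Eventually.of_forall fun E => Finset.sum_nonneg fun i _ => dist_nonneg) ?_
  filter_upwards [mem_inf_of_right (mem_principal_self _)] with E hE
  rw [Finset.mul_sum]
  exact Finset.sum_le_sum fun i hi => hfg _ (hE.1 i hi).1 _ (hE.1 i hi).2

/-- The amount by which the unrejected dynamics exceeds the level. -/
def excess (G : Data) (x : ℝ) (ψ : Path × Path) (t : ℝ) : ℝ :=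
  x + G.y * t + ψ.1 t - ψ.2 t - G.level

lemma continuous_excess (G : Data) (x : ℝ) (ψ : Path × Path) : Continuous (excess G x ψ) := by
  have h1 := ψ.1.continuous'
  have h2 := ψ.2.continuous'
  unfold excess
  fun_prop

/-- The amount rejected by reflection at the level. -/
def rejected (G : Data) (x : ℝ) (ψ : Path × Path) : ℝ → ℝ :=
  runningMax fun t => max 0 (excess G x ψ t)

lemma continuous_excess_pos (G : Data) (x : ℝ) (ψ : Path × Path) :
    Continuous fun t => max 0 (excess G x ψ t) :=
  continuous_const.max (continuous_excess G x ψ)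

lemma continuous_rejected (G : Data) (x : ℝ) (ψ : Path × Path) : Continuous (rejected G x ψ) :=
  continuous_runningMax (continuous_excess_pos G x ψ)

lemma excess_le_rejected (G : Data) (x : ℝ) (ψ : Path × Path) {t : ℝ} (ht : 0 ≤ t) :
    excess G x ψ t ≤ rejected G x ψ t :=
  (le_max_right _ _).trans (le_runningMax (continuous_excess_pos G x ψ) ht le_rfl)

lemma rejected_nonneg (G : Data) (x : ℝ) (ψ : Path × Path) {t : ℝ} (ht : 0 ≤ t) :
    0 ≤ rejected G x ψ t :=
  (le_max_left _ _).trans (le_runningMax (continuous_excess_pos G x ψ) ht le_rfl)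

lemma rejected_mono (G : Data) (x : ℝ) (ψ : Path × Path) {s t : ℝ} (hs : 0 ≤ s) (hst : s ≤ t) :
    rejected G x ψ s ≤ rejected G x ψ t :=
  runningMax_mono (continuous_excess_pos G x ψ) hs hst

/-- If more is rejected on `(s,t]`, the rejected amount is the excess at some time of `(s,t]`. -/
lemma exists_rejected_eq (G : Data) (x : ℝ) (ψ : Path × Path) {s t : ℝ} (hs : 0 ≤ s)
    (hst : s ≤ t) (hlt : rejected G x ψ s < rejected G x ψ t) :
    ∃ u ∈ Ioc s t, rejected G x ψ t = excess G x ψ u := by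
  have hc := continuous_excess_pos G x ψ
  obtain ⟨u, hu, e⟩ := exists_eq_runningMax hc (hs.trans hst)
  have e' : rejected G x ψ t = max 0 (excess G x ψ u) := e
  refine ⟨u, ⟨?_, hu.2⟩, ?_⟩
  · by_contra! h
    have : max 0 (excess G x ψ u) ≤ rejected G x ψ s := le_runningMax hc hu.1 h
    linarith
  · rcases le_total (excess G x ψ u) 0 with h | h
    · rw [max_eq_left h] at e'
      linarith [rejected_nonneg G x ψ hs]
    · rw [e', max_eq_right h]

/-- The strategy that reflects the dynamics at the level. -/
def reflection (G : Data) (x : ℝ) (ψ : Path × Path) : Rejection where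
  toFun t := if t < 0 then 0 else rejected G x ψ t
  mono' s t hst := by
    dsimp only
    split_ifs with h1 h2 h2
    · rfl
    · exact rejected_nonneg G x ψ (not_lt.1 h2)
    · linarith
    · exact rejected_mono G x ψ (not_lt.1 h1) hst
  right_continuous' t := by
    rcases lt_or_ge t 0 with h | h
    · refine ContinuousAt.continuousWithinAt (continuousAt_const (y := (0 : ℝ)) |>.congr ?_)
      filter_upwards [gt_mem_nhds h] with s hs using (if_pos hs).symm
    · refine (continuous_rejected G x ψ).continuousWithinAt.congr (fun s hs => ?_) ?_
      · exact if_neg (not_lt.2 (h.trans hs))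
      · exact if_neg (not_lt.2 h)
  zero_of_neg' t ht := if_pos ht

/-! ### Upper bound: verification of the reflection strategy -/

section reflection

variable {G : Data} {x : ℝ} {ψ : Path × Path}

lemma reflection_apply {t : ℝ} (ht : 0 ≤ t) : reflection G x ψ t = rejected G x ψ t :=
  if_neg (not_lt.2 ht)

lemma dynamics_reflection {t : ℝ} (ht : 0 ≤ t) :
    dynamics G x ψ (reflection G x ψ) t = excess G x ψ t + G.level - rejected G x ψ t := by
  rw [dynamics, reflection_apply ht, excess]
  ring

lemma excess_zero : excess G x ψ 0 = x - G.level := by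
  simp [excess, ψ.1.zero_of_nonpos' 0 le_rfl, ψ.2.zero_of_nonpos' 0 le_rfl]

lemma rejected_zero : rejected G x ψ 0 = max 0 (x - G.level) := by
  obtain ⟨s, hs, e⟩ := exists_eq_runningMax (continuous_excess_pos G x ψ) (le_refl (0 : ℝ))
  obtain rfl : s = 0 := le_antisymm hs.2 hs.1
  rwa [excess_zero] at e

lemma dynamics_reflection_zero : dynamics G x ψ (reflection G x ψ) 0 = min x G.level := by
  rw [dynamics_reflection le_rfl, excess_zero, rejected_zero]
  rcases le_total x G.level with h | h
  · rw [max_eq_left (by linarith), min_eq_left h]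
    ring
  · rw [max_eq_right (by linarith), min_eq_right h]
    ring

lemma dynamics_reflection_le {t : ℝ} (ht : 0 ≤ t) :
    dynamics G x ψ (reflection G x ψ) t ≤ G.level := by
  rw [dynamics_reflection ht]
  linarith [excess_le_rejected G x ψ ht]

/-- After the possible jump at time `0` the reflected dynamics is continuous, so it would have to
hit zero before becoming negative. -/
lemma dynamics_reflection_nonneg (hL : 0 ≤ opL G G.r) (hx : 0 ≤ x) {t : ℝ} (ht : 0 ≤ t)
    (hτ : (t : EReal) ≤ hitTime G x ψ (reflection G x ψ)) :
    0 ≤ dynamics G x ψ (reflection G x ψ) t := by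
  by_contra! hneg
  have hcont : ContinuousOn (dynamics G x ψ (reflection G x ψ)) (Icc 0 t) := by
    refine ContinuousOn.congr (f := fun t => excess G x ψ t + G.level - rejected G x ψ t) ?_
      fun s hs => dynamics_reflection hs.1
    exact (((continuous_excess G x ψ).add continuous_const).sub
      (continuous_rejected G x ψ)).continuousOn
  have h0 : 0 ≤ dynamics G x ψ (reflection G x ψ) 0 := by
    rw [dynamics_reflection_zero]
    exact le_min hx (level_mem hL).1
  obtain ⟨s, hs, hs0⟩ := intermediate_value_Icc' ht hcont ⟨hneg.le, h0⟩
  have hst : s ≠ t := by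
    rintro rfl
    exact hneg.ne hs0
  exact le_hitTime_iff.1 hτ s ⟨hs.1, lt_of_le_of_ne hs.2 hst⟩ hs0

lemma reflection_admissible (hL : 0 ≤ opL G G.r) (hx : 0 ≤ x) :
    reflection G x ∈ admissible G x := by
  refine ⟨fun ψ ψ' t ht h s hs => ?_, fun ψ t ht hτ => ?_⟩
  · rw [reflection_apply hs.1, reflection_apply hs.1]
    refine runningMax_congr hs.1 fun u hu => ?_
    obtain ⟨h1, h2⟩ := h u ⟨hu.1, hu.2.trans hs.2⟩
    simp only [excess, h1, h2]
  · exact ⟨dynamics_reflection_nonneg hL hx ht hτ,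
      (dynamics_reflection_le ht).trans (level_mem hL).2⟩

lemma excess_absolutelyContinuous {T : ℝ} (h₁ : AbsolutelyContinuousOnInterval ψ.1 0 T)
    (h₂ : AbsolutelyContinuousOnInterval ψ.2 0 T) :
    AbsolutelyContinuousOnInterval (excess G x ψ) 0 T := by
  have h : AbsolutelyContinuousOnInterval (fun t => x + G.y * t - G.level) 0 T :=
    ContDiffOn.absolutelyContinuousOnInterval (by fun_prop)
  have e : excess G x ψ = (fun t => x + G.y * t - G.level) + (ψ.1.toFun - ψ.2.toFun) := by
    ext t
    simp only [excess, Pi.add_apply, Pi.sub_apply]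
    ring
  exact e ▸ h.add (h₁.sub h₂)

/-- If the rejected amount grows on `(s,t]`, it ends at the excess at some `u` in `(s,t]` and starts
at or above the excess at `s`. Its increment is thus at most the variation of the excess. -/
lemma rejected_absolutelyContinuous {T : ℝ} (hT : 0 ≤ T)
    (h : AbsolutelyContinuousOnInterval (excess G x ψ) 0 T) :
    AbsolutelyContinuousOnInterval (rejected G x ψ) 0 T := by
  have hi := h.intervalIntegrable_deriv.abs
  have hA := hi.absolutelyContinuousOnInterval_intervalIntegral (c := 0) left_mem_uIcc
  refine absolutelyContinuousOnInterval_of_dist_le (K := 1) hA ?_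
  have key : ∀ s ∈ Icc 0 T, ∀ t ∈ Icc 0 T, s ≤ t → dist (rejected G x ψ s) (rejected G x ψ t) ≤
      1 * dist (∫ v in (0 : ℝ)..s, |deriv (excess G x ψ) v|)
        (∫ v in (0 : ℝ)..t, |deriv (excess G x ψ) v|) := by
    intro s hs t ht hst
    have hsub : ∀ {a b : ℝ}, a ∈ Icc 0 T → b ∈ Icc 0 T → uIcc a b ⊆ uIcc 0 T := by
      intro a b ha hb
      rw [uIcc_of_le hT]
      exact uIcc_subset_Icc ha hb
    have h0 : (0 : ℝ) ∈ Icc 0 T := ⟨le_rfl, hT⟩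
    rw [one_mul, dist_comm, dist_comm (∫ v in (0 : ℝ)..s, |deriv (excess G x ψ) v|),
      Real.dist_eq, Real.dist_eq, intervalIntegral.integral_interval_sub_left
        (hi.mono_set (hsub h0 ht)) (hi.mono_set (hsub h0 hs)),
      abs_of_nonneg (sub_nonneg.2 (rejected_mono G x ψ hs.1 hst)),
      abs_of_nonneg (intervalIntegral.integral_nonneg hst fun u _ => abs_nonneg _)]
    rcases (rejected_mono G x ψ hs.1 hst).eq_or_lt with e | hlt
    · rw [e, sub_self]
      exact intervalIntegral.integral_nonneg hst fun u _ => abs_nonneg _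
    · obtain ⟨u, hu, e⟩ := exists_rejected_eq G x ψ hs.1 hst hlt
      have hu' : u ∈ Icc 0 T := ⟨hs.1.trans hu.1.le, hu.2.trans ht.2⟩
      have e2 : rejected G x ψ t - excess G x ψ s = ∫ v in s..u, deriv (excess G x ψ) v := by
        rw [e, (h.mono (hsub hs hu')).integral_deriv_eq_sub]
      have e3 : ∫ v in s..u, deriv (excess G x ψ) v ≤ ∫ v in s..u, |deriv (excess G x ψ) v| :=
        (le_abs_self _).trans (intervalIntegral.abs_integral_le_integral_abs hu.1.le)
      have e4 : ∫ v in s..u, |deriv (excess G x ψ) v| ≤ ∫ v in s..t, |deriv (excess G x ψ) v| :=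
        intervalIntegral.integral_mono_interval le_rfl hu.1.le hu.2
          (Eventually.of_forall fun v => abs_nonneg _) (hi.mono_set (hsub hs ht))
      linarith [excess_le_rejected G x ψ hs.1]
  intro s hs t ht
  rw [uIcc_of_le hT] at hs ht
  rcases le_total s t with hst | hst
  · exact key s hs t ht hst
  · rw [dist_comm, dist_comm (∫ v in (0 : ℝ)..s, |deriv (excess G x ψ) v|)]
    exact key t ht s hs hst

lemma slopeInt_dist_le (hy : G.r / (4 * G.c) ≤ -G.y) (a b : ℝ) :
    dist (slopeInt G a) (slopeInt G b) ≤ G.r * dist a b := by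
  have hL := opL_r_nonneg hy
  have : LipschitzWith G.r.toNNReal (slopeInt G) :=
    lipschitzWith_of_nnnorm_deriv_le (fun z => (hasDerivAt_slopeInt hL z).differentiableAt)
      fun z => by
        rw [← NNReal.coe_le_coe, Real.coe_toNNReal _ G.r_pos.le, coe_nnnorm, (hasDerivAt_slopeInt hL z).deriv, Real.norm_eq_abs,
          abs_of_nonneg (valueSlope_nonneg hy z)]
        exact valueSlope_le_r hL z
  have h := this.dist_le_mul a b
  rwa [Real.coe_toNNReal _ G.r_pos.le] at h

lemma hasDerivAt_excess {t a b : ℝ} (h₁ : HasDerivAt ψ.1 a t) (h₂ : HasDerivAt ψ.2 b t) :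
    HasDerivAt (excess G x ψ) (G.y + (a - b)) t := by
  have := ((((hasDerivAt_id t).const_mul G.y).const_add x).add h₁).sub h₂ |>.sub_const G.level
  refine this.congr_deriv ?_
  ring

/-- The infinitesimal inequality behind the verification of the reflection strategy. -/
lemma reflection_generator_le (hL : 0 ≤ opL G G.r) {t a b ρ' : ℝ} (ht : 0 < t)
    (h₁ : HasDerivAt ψ.1 a t) (h₂ : HasDerivAt ψ.2 b t) (hρ : HasDerivAt (rejected G x ψ) ρ' t)
    (h0 : 0 ≤ excess G x ψ t + G.level - rejected G x ψ t) :
    valueSlope G (excess G x ψ t + G.level - rejected G x ψ t) * (G.y + (a - b) - ρ') + G.r * ρ'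
      + G.h (excess G x ψ t + G.level - rejected G x ψ t)
      - (G.c₁ * a ^ 2 + G.c₂ * b ^ 2) ≤ 0 := by
  have hk := hasDerivAt_excess (G := G) (x := x) h₁ h₂
  have hφ : HasDerivAt (fun s => excess G x ψ s + G.level - rejected G x ψ s)
      (G.y + (a - b) - ρ') t := (hk.add_const _).sub hρ
  have hle := excess_le_rejected G x ψ ht.le
  -- On contact the dynamics is at its maximal value, the level, so its derivative vanishes and `ρ'`
  -- equals the free velocity; the Legendre bound is used with `p = r`. Off contact nothing is
  -- rejected, and the bound is used with the lower root.
  rcases hle.eq_or_lt with e | hlt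
  · have hmax : IsLocalMax (fun s => excess G x ψ s + G.level - rejected G x ψ s) t := by
      filter_upwards [lt_mem_nhds ht] with s hs
      have := excess_le_rejected G x ψ hs.le
      linarith
    have hd := hmax.hasDerivAt_eq_zero hφ
    rw [hd, show excess G x ψ t + G.level - rejected G x ψ t = G.level by rw [e]; ring]
    have h1 := mul_sub_le_neg_opL G G.r a b
    have h2 := h_le_opL hL (level_mem hL).1 le_rfl
    have h3 : ρ' = G.y + (a - b) := by linarith
    rw [h3]
    linarith
  · have hρ0 : ρ' = 0 := by
      have hge : 0 ≤ ρ' := by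
        refine nonneg_of_hasDerivWithinAt_Ioi hρ.hasDerivWithinAt ?_
        filter_upwards [self_mem_nhdsWithin] with s hs
        exact rejected_mono G x ψ ht.le (le_of_lt hs)
      have hle' : 0 ≤ -ρ' := by
        refine nonneg_of_hasDerivWithinAt_Ioi hρ.neg.hasDerivWithinAt ?_
        have hev : ∀ᶠ u in 𝓝 t, excess G x ψ u < rejected G x ψ t :=
          (continuous_excess G x ψ).continuousAt.eventually_lt continuousAt_const hlt
        obtain ⟨δ, hδ, hball⟩ := Metric.eventually_nhds_iff.1 hev
        filter_upwards [Ioo_mem_nhdsGT (show t < t + δ by linarith)] with s hs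
        simp only [Pi.neg_apply, neg_le_neg_iff]
        by_contra! hcon
        obtain ⟨u, hu, e⟩ := exists_rejected_eq G x ψ ht.le hs.1.le hcon
        have : excess G x ψ u < rejected G x ψ t := hball (by
          rw [Real.dist_eq, abs_of_pos (sub_pos.2 hu.1)]
          linarith [hu.2, hs.2])
        linarith
      linarith
    set z := excess G x ψ t + G.level - rejected G x ψ t
    have h1 := mul_sub_le_neg_opL G (valueSlope G z) a b
    have h2 : opL G (valueSlope G z) = G.h z := by
      rw [opL_valueSlope hL, clamp_of_mem h0 (by simp only [z]; linarith)]
    rw [hρ0]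
    linarith

/-- The generator inequality is integrated over `[0, τ]`. The reflected dynamics never exceeds the
level, so the smooth `slopeInt` replaces `potential`, and the initial jump costs the linear part `r
(x - level)⁺`. -/
theorem cost_reflection_le (hy : G.r / (4 * G.c) ≤ -G.y) (hx : x ∈ Icc 0 G.D)
    (hψ : ψ ∈ hittingControls G x (reflection G x)) :
    cost G x ψ (reflection G x ψ) ≤ (potential G x : EReal) := by
  have hL := opL_r_nonneg hy
  obtain ⟨τ, hτ0, hτ, hφτ⟩ := exists_hitTime_eq hψ
  by_cases hrate : rate G τ ψ = ∞
  · rw [cost, hτ]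
    simp only [EReal.toReal_coe, hrate, EReal.coe_ennreal_top, EReal.sub_top]
    exact bot_le
  obtain ⟨hr₁, hr₂⟩ := ENNReal.add_ne_top.1 hrate
  obtain ⟨hac₁, hi₁⟩ := of_action_ne_top G.c₁_pos hτ0 hr₁
  obtain ⟨hac₂, hi₂⟩ := of_action_ne_top G.c₂_pos hτ0 hr₂
  have hpos : ∀ κ : ℝ, 0 < κ → ∀ f : ℝ → ℝ, 0 ≤ κ * ∫ s in (0 : ℝ)..τ, (deriv f s) ^ 2 :=
    fun κ hκ f => mul_nonneg hκ.le (intervalIntegral.integral_nonneg hτ0 fun s _ => sq_nonneg _)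
  have hrE : rate G τ ψ = ENNReal.ofReal (G.c₁ * (∫ s in (0 : ℝ)..τ, (deriv ψ.1 s) ^ 2) +
      G.c₂ * ∫ s in (0 : ℝ)..τ, (deriv ψ.2 s) ^ 2) := by
    rw [ENNReal.ofReal_add (hpos _ G.c₁_pos _) (hpos _ G.c₂_pos _), rate,
      action_eq_ofReal G.c₁_pos.le hτ0 hac₁ hi₁, action_eq_ofReal G.c₂_pos.le hτ0 hac₂ hi₂]
  rw [cost_eq hτ (add_nonneg (hpos _ G.c₁_pos _) (hpos _ G.c₂_pos _)) hrE, EReal.coe_le_coe_iff]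
  have hk := excess_absolutelyContinuous (G := G) (x := x) hac₁ hac₂
  have hR := rejected_absolutelyContinuous hτ0 hk
  set φ : ℝ → ℝ := fun t => excess G x ψ t + G.level - rejected G x ψ t with hφdef
  have hφeq : ∀ t, 0 ≤ t → dynamics G x ψ (reflection G x ψ) t = φ t := fun t ht =>
    dynamics_reflection ht
  have hφac : AbsolutelyContinuousOnInterval φ 0 τ := by
    have hconst : AbsolutelyContinuousOnInterval (fun _ : ℝ => G.level) 0 τ :=
      ContDiffOn.absolutelyContinuousOnInterval contDiffOn_const
    exact (hk.add hconst).sub hR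
  have hF : AbsolutelyContinuousOnInterval (fun t => slopeInt G (φ t)) 0 τ :=
    absolutelyContinuousOnInterval_of_dist_le hφac fun s _ t _ => slopeInt_dist_le hy _ _
  have hφmem : ∀ t ∈ Icc 0 τ, φ t ∈ Icc 0 G.D := fun t ht => by
    rw [← hφeq t ht.1]
    exact (reflection_admissible hL hx.1).2 ψ t ht.1 (by rw [hτ]; exact_mod_cast ht.2)
  have hh : IntervalIntegrable (fun t => G.h (φ t)) volume 0 τ := by
    refine ContinuousOn.intervalIntegrable ?_
    rw [uIcc_of_le hτ0]
    refine G.h_cont.comp ?_ hφmem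
    exact (((continuous_excess G x ψ).add continuous_const).sub
      (continuous_rejected G x ψ)).continuousOn
  have hint := (((hF.intervalIntegrable_deriv.add (hR.intervalIntegrable_deriv.const_mul G.r)).add
    hh).sub ((hi₁.const_mul G.c₁).add (hi₂.const_mul G.c₂)))
  have hle : ∫ t in (0 : ℝ)..τ, (deriv (fun t => slopeInt G (φ t)) t
      + G.r * deriv (rejected G x ψ) t + G.h (φ t)
      - (G.c₁ * (deriv ψ.1 t) ^ 2 + G.c₂ * (deriv ψ.2 t) ^ 2)) ≤ ∫ t in (0 : ℝ)..τ, (0 : ℝ) := by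
    refine intervalIntegral.integral_mono_ae_restrict hτ0 hint intervalIntegrable_const ?_
    rw [EventuallyLE, ae_restrict_iff' measurableSet_Icc]
    filter_upwards [hac₁.ae_differentiableAt, hac₂.ae_differentiableAt, hR.ae_differentiableAt,
      Measure.ae_ne volume (0 : ℝ)] with t h1 h2 h3 h4 ht
    have htu : t ∈ uIcc 0 τ := by rwa [uIcc_of_le hτ0]
    have ht0 : 0 < t := lt_of_le_of_ne ht.1 (Ne.symm h4)
    have d1 := (h1 htu).hasDerivAt
    have d2 := (h2 htu).hasDerivAt
    have d3 := (h3 htu).hasDerivAt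
    have dk : HasDerivAt φ (G.y + (deriv ψ.1 t - deriv ψ.2 t) - deriv (rejected G x ψ) t) t :=
      ((hasDerivAt_excess d1 d2).add_const _).sub d3
    have dF := (hasDerivAt_slopeInt hL (φ t)).comp t dk
    rw [show deriv (fun t => slopeInt G (φ t)) t = _ from dF.deriv]
    exact reflection_generator_le hL ht0 d1 d2 d3 (hφmem t ht).1
  rw [intervalIntegral.integral_sub
      ((hF.intervalIntegrable_deriv.add (hR.intervalIntegrable_deriv.const_mul G.r)).add hh)
      ((hi₁.const_mul G.c₁).add (hi₂.const_mul G.c₂)),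
    intervalIntegral.integral_add
      (hF.intervalIntegrable_deriv.add (hR.intervalIntegrable_deriv.const_mul G.r)) hh,
    intervalIntegral.integral_add hF.intervalIntegrable_deriv
      (hR.intervalIntegrable_deriv.const_mul G.r),
    intervalIntegral.integral_add (hi₁.const_mul G.c₁) (hi₂.const_mul G.c₂),
    intervalIntegral.integral_const_mul, intervalIntegral.integral_const_mul,
    intervalIntegral.integral_const_mul, hF.integral_deriv_eq_sub, hR.integral_deriv_eq_sub,
    intervalIntegral.integral_zero] at hle
  have hφτ' : φ τ = 0 := by rw [← hφeq τ hτ0, hφτ]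
  have hφ0 : φ 0 = min x G.level := by rw [← hφeq 0 le_rfl, dynamics_reflection_zero]
  have hcongr : ∫ t in (0 : ℝ)..τ, G.h (dynamics G x ψ (reflection G x ψ) t)
      = ∫ t in (0 : ℝ)..τ, G.h (φ t) := intervalIntegral.integral_congr fun t ht => by
    rw [uIcc_of_le hτ0] at ht
    simp only [hφeq t ht.1]
  rw [hφτ', hφ0, slopeInt_zero, rejected_zero, max_comm] at hle
  rw [hcongr, reflection_apply hτ0, potential]
  linarith

theorem value_le_potential (hy : G.r / (4 * G.c) ≤ -G.y) (hx : x ∈ Icc 0 G.D) :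
    value G x ≤ (potential G x : EReal) :=
  iInf₂_le_of_le (reflection G x) (reflection_admissible (opL_r_nonneg hy) hx.1)
    (iSup₂_le fun _ hψ => cost_reflection_le hy hx hψ)

end reflection

/-! ### Lower bound: play of the maximizing player -/

section lowerBound

variable {G : Data} {x : ℝ}

lemma measurable_dynamics (ψ : Path × Path) (ϱ : Rejection) : Measurable (dynamics G x ψ ϱ) := by
  have h1 := ψ.1.continuous'.measurable
  have h2 := ψ.2.continuous'.measurable
  have h3 := ϱ.mono'.measurable
  unfold dynamics
  fun_prop

lemma intervalIntegrable_h_dynamics {ψ : Path × Path} {ϱ : Rejection} {T : ℝ} (hT : 0 ≤ T)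
    (h : ∀ t ∈ Icc 0 T, dynamics G x ψ ϱ t ∈ Icc 0 G.D) :
    IntervalIntegrable (fun t => G.h (dynamics G x ψ ϱ t)) volume 0 T := by
  have hD := G.D_pos.le
  -- `h` is controlled only on `[0,D]`; truncating its argument gives a globally continuous
  -- function.
  have hbar : Continuous fun z => G.h (max 0 (min z G.D)) :=
    G.h_cont.comp_continuous (by fun_prop) fun z =>
      ⟨le_max_left _ _, max_le hD (min_le_right _ _)⟩
  have hm : Measurable fun t => G.h (max 0 (min (dynamics G x ψ ϱ t) G.D)) :=
    hbar.measurable.comp (measurable_dynamics ψ ϱ)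
  have hi : IntervalIntegrable (fun t => G.h (max 0 (min (dynamics G x ψ ϱ t) G.D)))
      volume 0 T := by
    refine intervalIntegrable_const (c := G.h G.D) |>.mono_fun hm.aestronglyMeasurable ?_
    refine Eventually.of_forall fun t => ?_
    have hmem : max 0 (min (dynamics G x ψ ϱ t) G.D) ∈ Icc 0 G.D :=
      ⟨le_max_left _ _, max_le hD (min_le_right _ _)⟩
    dsimp only
    rw [Real.norm_eq_abs, Real.norm_eq_abs, abs_of_nonneg (h_nonneg hmem),
      abs_of_nonneg (h_nonneg ⟨hD, le_rfl⟩)]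
    exact G.h_strictMono.monotoneOn hmem ⟨hD, le_rfl⟩ hmem.2
  refine hi.congr fun t ht => ?_
  rw [uIoc_of_le hT] at ht
  have := h t ⟨ht.1.le, ht.2⟩
  simp only [min_eq_left this.2, max_eq_right this.1]

/-- Multiples of a path. -/
def Path.smul (κ : ℝ) (ζ : Path) : Path where
  toFun t := κ * ζ t
  continuous' := ζ.continuous'.const_mul κ
  zero_of_nonpos' t ht := by rw [ζ.zero_of_nonpos' t ht, mul_zero]

/-- The pair of paths of minimal rate whose difference is the given path. -/
def optimalPair (G : Data) (ζ : Path) : Path × Path :=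
  (ζ.smul (G.c / G.c₁), ζ.smul (-(G.c / G.c₂)))

lemma c_div_add (G : Data) : G.c / G.c₁ + G.c / G.c₂ = 1 := by
  have h₁ := G.c₁_pos
  have h₂ := G.c₂_pos
  unfold Data.c
  field_simp

lemma optimalPair_sub (ζ : Path) (t : ℝ) :
    (optimalPair G ζ).1 t - (optimalPair G ζ).2 t = ζ t := by
  show G.c / G.c₁ * ζ t - -(G.c / G.c₂) * ζ t = ζ t
  linear_combination ζ t * c_div_add G

/-- The zero path. -/
def Path.zero : Path where
  toFun _ := 0
  continuous' := continuous_const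
  zero_of_nonpos' _ _ := rfl

/-- The path that follows `ζ` until `t₀` and then has slope `v`. -/
def Path.extend (ζ : Path) {t₀ : ℝ} (ht₀ : 0 ≤ t₀) (v : ℝ) : Path where
  toFun t := ζ (min t t₀) + v * max (t - t₀) 0
  continuous' := by
    have := ζ.continuous'
    fun_prop
  zero_of_nonpos' t ht := by
    rw [min_eq_left (ht.trans ht₀), ζ.zero_of_nonpos' t ht, max_eq_right (by linarith)]
    simp

section extend

variable {ζ : Path} {t₀ : ℝ} {ht₀ : 0 ≤ t₀} {v : ℝ}

lemma extend_of_le {t : ℝ} (ht : t ≤ t₀) : ζ.extend ht₀ v t = ζ t := by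
  show ζ (min t t₀) + v * max (t - t₀) 0 = ζ t
  rw [min_eq_left ht, max_eq_right (by linarith), mul_zero, add_zero]

lemma extend_of_ge {t : ℝ} (ht : t₀ ≤ t) : ζ.extend ht₀ v t = ζ t₀ + v * (t - t₀) := by
  show ζ (min t t₀) + v * max (t - t₀) 0 = _
  rw [min_eq_right ht, max_eq_left (by linarith)]

lemma extend_lipschitz {K : NNReal} (h : LipschitzWith K ζ) :
    LipschitzWith (K + ‖v‖₊) (ζ.extend ht₀ v) := by
  have h1 : LipschitzWith K fun t => ζ (min t t₀) := by
    simpa [Function.comp_def] using h.comp (LipschitzWith.id.min_const t₀)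
  have h2 : LipschitzWith ‖v‖₊ fun t => v * max (t - t₀) 0 := by
    refine LipschitzWith.of_dist_le_mul fun a b => ?_
    rw [Real.dist_eq, ← mul_sub, abs_mul, coe_nnnorm, Real.norm_eq_abs]
    gcongr
    refine (abs_max_sub_max_le_abs _ _ _).trans_eq ?_
    rw [Real.dist_eq]
    congr 1
    ring
  exact h1.add h2

lemma deriv_extend_of_lt {t : ℝ} (ht : t < t₀) : deriv (ζ.extend ht₀ v) t = deriv ζ t := by
  refine EventuallyEq.deriv_eq ?_
  filter_upwards [gt_mem_nhds ht] with s hs using extend_of_le hs.le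

lemma deriv_extend_of_gt {t : ℝ} (ht : t₀ < t) : deriv (ζ.extend ht₀ v) t = v := by
  have h : HasDerivAt (fun s => ζ t₀ + v * (s - t₀)) v t := by
    simpa using (((hasDerivAt_id t).sub_const t₀).const_mul v).const_add (ζ t₀)
  refine (h.congr_of_eventuallyEq ?_).deriv
  filter_upwards [lt_mem_nhds ht] with s hs using extend_of_ge hs.le

end extend

lemma intervalIntegrable_deriv_sq {ζ : ℝ → ℝ} {K : NNReal} (h : LipschitzWith K ζ) (a b : ℝ) :
    IntervalIntegrable (fun s => (deriv ζ s) ^ 2) volume a b := by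
  refine intervalIntegrable_const (c := (K : ℝ) ^ 2) |>.mono_fun
    ((measurable_deriv _).pow_const 2).aestronglyMeasurable (Eventually.of_forall fun s => ?_)
  have := norm_deriv_le_of_lipschitz h (x₀ := s)
  dsimp only
  rw [norm_pow, norm_pow, NNReal.norm_eq]
  gcongr

lemma integral_deriv_extend_sq {ζ : Path} {t₀ : ℝ} (ht₀ : 0 ≤ t₀) {v t : ℝ} {K : NNReal}
    (h : LipschitzWith K ζ) (ht : t₀ ≤ t) :
    ∫ s in (0 : ℝ)..t, (deriv (ζ.extend ht₀ v) s) ^ 2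
      = (∫ s in (0 : ℝ)..t₀, (deriv ζ s) ^ 2) + v ^ 2 * (t - t₀) := by
  have hl := extend_lipschitz (ht₀ := ht₀) (v := v) h
  rw [← intervalIntegral.integral_add_adjacent_intervals
    (intervalIntegrable_deriv_sq hl 0 t₀) (intervalIntegrable_deriv_sq hl t₀ t)]
  congr 1
  · refine intervalIntegral.integral_congr_Ioo_of_le ht₀ fun s hs => ?_
    simp only [deriv_extend_of_lt hs.2]
  · rw [intervalIntegral.integral_congr_Ioo_of_le (g := fun _ => v ^ 2) ht fun s hs => by
      simp only [deriv_extend_of_gt hs.1], intervalIntegral.integral_const, smul_eq_mul, mul_comm]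

/-- The dynamics under a strategy and the optimal pair of a path. -/
def traj (G : Data) (x : ℝ) (α : Path × Path → Rejection) (ζ : Path) : ℝ → ℝ :=
  dynamics G x (optimalPair G ζ) (α (optimalPair G ζ))

/-- The payoff accumulated up to time `T`. -/
def payoff (G : Data) (x : ℝ) (α : Path × Path → Rejection) (ζ : Path) (T : ℝ) : ℝ :=
  (∫ t in (0 : ℝ)..T, G.h (traj G x α ζ t)) + G.r * α (optimalPair G ζ) T
    - G.c * ∫ s in (0 : ℝ)..T, (deriv ζ s) ^ 2

/-- The game driven by a Lipschitz path has not ended before time `T`. -/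
structure IsAlive (G : Data) (x : ℝ) (α : Path × Path → Rejection) (ζ : Path) (T : ℝ) :
    Prop where
  nonneg : 0 ≤ T
  lipschitz : ∃ K, LipschitzWith K ζ
  ne_zero : ∀ t ∈ Ico 0 T, traj G x α ζ t ≠ 0

variable {α : Path × Path → Rejection} {ζ : Path} {T : ℝ}

lemma traj_eq (t : ℝ) :
    traj G x α ζ t = x + G.y * t + ζ t - α (optimalPair G ζ) t := by
  rw [traj, dynamics, ← optimalPair_sub (G := G) ζ t]
  ring

lemma IsAlive.traj_mem (h : IsAlive G x α ζ T) (hα : α ∈ admissible G x) {t : ℝ}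
    (ht : t ∈ Icc 0 T) : traj G x α ζ t ∈ Icc 0 G.D :=
  hα.2 _ t ht.1 (le_hitTime_iff.2 fun s hs => h.ne_zero s ⟨hs.1, hs.2.trans_le ht.2⟩)

lemma rate_optimalPair (hT : 0 ≤ T) {K : NNReal} (h : LipschitzWith K ζ) :
    rate G T (optimalPair G ζ) = ENNReal.ofReal (G.c * ∫ s in (0 : ℝ)..T, (deriv ζ s) ^ 2) := by
  have hi0 : 0 ≤ ∫ s in (0 : ℝ)..T, (deriv ζ s) ^ 2 :=
    intervalIntegral.integral_nonneg hT fun s _ => sq_nonneg _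
  have key : ∀ κ a : ℝ, 0 ≤ κ → action κ T (ζ.smul a)
      = ENNReal.ofReal (κ * a ^ 2 * ∫ s in (0 : ℝ)..T, (deriv ζ s) ^ 2) := by
    intro κ a hκ
    have hac : AbsolutelyContinuousOnInterval (ζ.smul a) 0 T :=
      (h.lipschitzOnWith (s := uIcc 0 T)).absolutelyContinuousOnInterval.const_mul a
    have hd : ∀ s, (deriv (ζ.smul a) s) ^ 2 = a ^ 2 * (deriv ζ s) ^ 2 := fun s => by
      rw [← mul_pow]
      congr 1
      exact deriv_const_mul_field a
    have hi := (intervalIntegrable_deriv_sq h 0 T).const_mul (a ^ 2)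
    rw [action_eq_ofReal hκ hT hac (by simpa only [hd] using hi)]
    simp only [hd, intervalIntegral.integral_const_mul, mul_assoc]
  have h₁ := G.c₁_pos
  have h₂ := G.c₂_pos
  rw [rate, optimalPair, key _ _ h₁.le, key _ _ h₂.le,
    ← ENNReal.ofReal_add (by positivity) (by positivity), ← add_mul]
  congr 2
  have e := c_div_add G
  have e2 : G.c₁ * (G.c / G.c₁) ^ 2 + G.c₂ * (-(G.c / G.c₂)) ^ 2
      = G.c * (G.c / G.c₁ + G.c / G.c₂) := by
    field_simp
  rw [e2, e, mul_one]

/-- When the game ends, the accumulated payoff is the cost. -/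
lemma IsAlive.payoff_le (h : IsAlive G x α ζ T) (h0 : traj G x α ζ T = 0) :
    (payoff G x α ζ T : EReal) ≤ ⨆ ψ ∈ hittingControls G x α, cost G x ψ (α ψ) := by
  have hτ : hitTime G x (optimalPair G ζ) (α (optimalPair G ζ)) = T :=
    hitTime_eq h.nonneg h0 h.ne_zero
  obtain ⟨K, hK⟩ := h.lipschitz
  refine le_iSup₂_of_le (optimalPair G ζ) (hτ.trans_lt (EReal.coe_lt_top T)) ?_
  rw [cost_eq hτ (mul_nonneg G.c_pos.le (intervalIntegral.integral_nonneg h.nonneg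
    fun s _ => sq_nonneg _)) (rate_optimalPair h.nonneg hK)]
  rfl

/-- Following slope `v` until the dynamics falls to level `z` or a time `M` has passed. -/
lemma IsAlive.exists_step (h : IsAlive G x α ζ T) (hα : α ∈ admissible G x) (v : ℝ) {z M : ℝ}
    (hz : z ∈ Icc 0 G.D) (hM : 0 ≤ M) :
    ∃ ζ' T' Δ, IsAlive G x α ζ' T' ∧ T ≤ T' ∧ 0 ≤ Δ ∧
      (traj G x α ζ' T' ≤ z ∨ T' = T + M) ∧
      traj G x α ζ' T' = traj G x α ζ T + (G.y + v) * (T' - T) - Δ ∧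
      payoff G x α ζ T + (G.h z - G.c * v ^ 2) * (T' - T) + G.r * Δ ≤ payoff G x α ζ' T' := by
  obtain ⟨K, hK⟩ := h.lipschitz
  set ζ' := ζ.extend h.nonneg v with hζ'
  -- By causality the past is unchanged up to and including `T`, so `Δ` below counts only rejections
  -- in `(T, T']`.
  have hagree : ∀ s ∈ Icc 0 T, α (optimalPair G ζ') s = α (optimalPair G ζ) s := by
    refine hα.1 _ _ T h.nonneg fun s hs => ?_
    have e : ζ' s = ζ s := extend_of_le hs.2
    exact ⟨congrArg (G.c / G.c₁ * ·) e, congrArg (-(G.c / G.c₂) * ·) e⟩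
  have htraj : ∀ s ∈ Icc 0 T, traj G x α ζ' s = traj G x α ζ s := fun s hs => by
    rw [traj_eq, traj_eq, hagree s hs, extend_of_le hs.2]
  obtain ⟨T', hTT', hexit, habove⟩ : ∃ T', T ≤ T' ∧ (traj G x α ζ' T' ≤ z ∨ T' = T + M) ∧
      ∀ t ∈ Ico T T', z < traj G x α ζ' t := by
    by_cases hex : ∃ t ∈ Icc T (T + M), traj G x α ζ' t ≤ z
    · obtain ⟨t, ht, htz⟩ := hex
      obtain ⟨σ, hσ, -, hσz, hlt⟩ := exists_first_hit (f := traj G x α ζ')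
        dynamics_rightContinuous isClosed_Iic ht.1 (mem_Iic.2 htz)
      exact ⟨σ, hσ, Or.inl hσz, fun t ht => not_le.1 (hlt t ht)⟩
    · push Not at hex
      exact ⟨T + M, by linarith, Or.inr rfl, fun t ht => hex t ⟨ht.1, ht.2.le⟩⟩
  have hT := h.nonneg
  have halive : IsAlive G x α ζ' T' := by
    refine ⟨hT.trans hTT', ⟨_, extend_lipschitz hK⟩, fun t ht => ?_⟩
    rcases lt_or_ge t T with htT | htT
    · rw [htraj t ⟨ht.1, htT.le⟩]
      exact h.ne_zero t ⟨ht.1, htT⟩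
    · exact (hz.1.trans_lt (habove t ⟨htT, ht.2⟩)).ne'
  refine ⟨ζ', T', α (optimalPair G ζ') T' - α (optimalPair G ζ) T, halive, hTT', ?_, hexit, ?_, ?_⟩
  · rw [← hagree T ⟨hT, le_rfl⟩]
    exact sub_nonneg.2 ((α (optimalPair G ζ')).mono' hTT')
  · rw [traj_eq, traj_eq, extend_of_ge hTT']
    ring
  · have hint : IntervalIntegrable (fun t => G.h (traj G x α ζ' t)) volume 0 T' :=
      intervalIntegrable_h_dynamics halive.nonneg fun t ht => halive.traj_mem hα ht
    have hi1 := hint.mono_set (c := 0) (d := T) (by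
      rw [uIcc_of_le hT, uIcc_of_le halive.nonneg]
      exact Icc_subset_Icc_right hTT')
    have hi2 := hint.mono_set (c := T) (d := T') (by
      rw [uIcc_of_le hTT', uIcc_of_le halive.nonneg]
      exact Icc_subset_Icc_left hT)
    have e1 : ∫ t in (0 : ℝ)..T, G.h (traj G x α ζ' t) = ∫ t in (0 : ℝ)..T, G.h (traj G x α ζ t) :=
      intervalIntegral.integral_congr fun t ht => by
        rw [uIcc_of_le hT] at ht
        simp only [htraj t ht]
    have e2 : G.h z * (T' - T) ≤ ∫ t in T..T', G.h (traj G x α ζ' t) := by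
      have := intervalIntegral.integral_mono_on_of_le_Ioo (μ := volume) hTT'
        (intervalIntegrable_const (μ := volume) (c := G.h z)) hi2 fun t ht =>
          G.h_strictMono.monotoneOn hz (halive.traj_mem hα ⟨hT.trans ht.1.le, ht.2.le⟩)
            (habove t ⟨ht.1.le, ht.2⟩).le
      rwa [intervalIntegral.integral_const, smul_eq_mul, mul_comm] at this
    have e3 := intervalIntegral.integral_add_adjacent_intervals hi1 hi2
    rw [payoff, payoff, integral_deriv_extend_sq h.nonneg hK hTT', ← e3, e1]
    linarith

/-! ### Potentials with a slightly smaller slope -/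

/-- The slope `(valueSlope - θ)⁺`. -/
def lowSlope (G : Data) (θ z : ℝ) : ℝ := max 0 (valueSlope G z - θ)

/-- The integral of the reduced slope. -/
def lowInt (G : Data) (θ z : ℝ) : ℝ := ∫ t in (0 : ℝ)..z, lowSlope G θ t

lemma continuous_lowSlope (hL : 0 ≤ opL G G.r) (θ : ℝ) : Continuous (lowSlope G θ) :=
  continuous_const.max ((continuous_valueSlope hL).sub continuous_const)

lemma lowSlope_mono (hL : 0 ≤ opL G G.r) (θ : ℝ) : Monotone (lowSlope G θ) := fun _ _ h =>
  max_le_max_left _ (sub_le_sub_right (valueSlope_mono hL h) θ)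

lemma lowInt_sub_le (hL : 0 ≤ opL G G.r) {θ a b z : ℝ} (hab : a ≤ b) (hbz : b ≤ z) :
    lowInt G θ b - lowInt G θ a ≤ lowSlope G θ z * (b - a) := by
  have hc := continuous_lowSlope hL θ
  rw [lowInt, lowInt, intervalIntegral.integral_interval_sub_left (hc.intervalIntegrable _ _)
    (hc.intervalIntegrable _ _)]
  have := intervalIntegral.integral_mono_on (μ := volume) hab (hc.intervalIntegrable _ _)
    (intervalIntegrable_const (c := lowSlope G θ z)) fun t ht =>
      lowSlope_mono hL θ (ht.2.trans hbz)
  rwa [intervalIntegral.integral_const, smul_eq_mul, mul_comm] at this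

lemma lowInt_nonneg {θ z : ℝ} (hz : 0 ≤ z) : 0 ≤ lowInt G θ z :=
  intervalIntegral.integral_nonneg hz fun _ _ => le_max_left _ _

lemma lowInt_zero {θ : ℝ} : lowInt G θ 0 = 0 := by simp [lowInt]

lemma slopeInt_le_lowInt (hL : 0 ≤ opL G G.r) {θ z : ℝ} (hz : 0 ≤ z) :
    slopeInt G z ≤ lowInt G θ z + θ * z := by
  have hc := continuous_lowSlope hL θ
  have hs := continuous_valueSlope hL
  have h : ∫ t in (0 : ℝ)..z, (valueSlope G t - θ) ≤ lowInt G θ z :=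
    intervalIntegral.integral_mono_on hz
      ((hs.sub continuous_const).intervalIntegrable _ _) (hc.intervalIntegrable _ _)
      fun t _ => le_max_right _ _
  rw [intervalIntegral.integral_sub (hs.intervalIntegrable _ _)
    (continuous_const.intervalIntegrable _ _), intervalIntegral.integral_const, smul_eq_mul,
    sub_zero, mul_comm z] at h
  unfold slopeInt
  linarith

/-- Within a cell the holding cost is bounded below by its value at the bottom, while the potential
drop is bounded by the slope at the top. The margin `θ` absorbs the mismatch. -/
lemma exists_partition (hL : 0 ≤ opL G G.r) {θ : ℝ} (hθ : 0 < θ) :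
    ∃ n : ℕ, 0 < n ∧ ∀ i : ℕ, i < n →
      valueSlope G ((i + 1 : ℕ) * (G.D / n)) - θ ≤ valueSlope G (i * (G.D / n)) := by
  have huc := isCompact_Icc.uniformContinuousOn_of_continuous
    (continuous_valueSlope hL).continuousOn (s := Icc 0 G.D)
  obtain ⟨δ, hδ, hlt⟩ := Metric.uniformContinuousOn_iff.1 huc θ hθ
  obtain ⟨n, hn⟩ := exists_nat_gt (G.D / δ)
  have hD := G.D_pos
  have hn0 : (0 : ℝ) < n := (div_pos hD hδ).trans hn
  refine ⟨n, by exact_mod_cast hn0, fun i hi => ?_⟩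
  have hi' : (i : ℝ) + 1 ≤ n := by exact_mod_cast hi
  have hs : 0 < G.D / n := by positivity
  have hnD : (n : ℝ) * (G.D / n) = G.D := by field_simp
  have hsδ : G.D / n < δ := by
    rw [div_lt_iff₀ hδ] at hn
    rw [div_lt_iff₀ hn0]
    linarith
  have h1 : ((i + 1 : ℕ) : ℝ) * (G.D / n) ≤ G.D := by
    push_cast
    calc ((i : ℝ) + 1) * (G.D / n) ≤ n * (G.D / n) := by gcongr
      _ = G.D := hnD
  have e : ((i + 1 : ℕ) : ℝ) * (G.D / n) = i * (G.D / n) + G.D / n := by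
    push_cast
    ring
  have := hlt (((i + 1 : ℕ) : ℝ) * (G.D / n)) ⟨by positivity, h1⟩ (i * (G.D / n))
    ⟨by positivity, by linarith⟩ (by
      rw [Real.dist_eq, e, add_sub_cancel_left, abs_of_pos hs]
      exact hsδ)
  rw [Real.dist_eq] at this
  linarith [le_abs_self (valueSlope G (((i + 1 : ℕ) : ℝ) * (G.D / n))
    - valueSlope G (i * (G.D / n)))]

/-- From any state the maximizing player can end the game and collect the reduced potential. -/
lemma IsAlive.exists_finish (hy : G.r / (4 * G.c) ≤ -G.y) (hα : α ∈ admissible G x) {θ : ℝ}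
    (hθ : 0 < θ) (h : IsAlive G x α ζ T) :
    ∃ ζ' T', IsAlive G x α ζ' T' ∧ traj G x α ζ' T' = 0 ∧
      payoff G x α ζ T + lowInt G θ (traj G x α ζ T) ≤ payoff G x α ζ' T' := by
  have hL := opL_r_nonneg hy
  have hc := G.c_pos
  have hm := neg_y_pos hy
  obtain ⟨n, hn, hpart⟩ := exists_partition hL hθ
  have hn0 : (0 : ℝ) < n := by exact_mod_cast hn
  have hnD : (n : ℝ) * (G.D / n) = G.D := by field_simp
  have hs : 0 < G.D / n := div_pos G.D_pos hn0
  suffices H : ∀ i : ℕ, i ≤ n → ∀ ζ T, IsAlive G x α ζ T → traj G x α ζ T ≤ i * (G.D / n) →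
      ∃ ζ' T', IsAlive G x α ζ' T' ∧ traj G x α ζ' T' = 0 ∧
        payoff G x α ζ T + lowInt G θ (traj G x α ζ T) ≤ payoff G x α ζ' T' by
    refine H n le_rfl ζ T h ?_
    rw [hnD]
    exact (h.traj_mem hα ⟨h.nonneg, le_rfl⟩).2
  intro i
  induction i with
  | zero =>
    intro _ ζ T h hle
    have h0 : traj G x α ζ T = 0 :=
      le_antisymm (by simpa using hle) (h.traj_mem hα ⟨h.nonneg, le_rfl⟩).1
    exact ⟨ζ, T, h, h0, by rw [h0, lowInt_zero, add_zero]⟩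
  | succ i ih =>
    intro hi ζ T h hle
    have hi' : ((i : ℝ)) ≤ n := by exact_mod_cast (Nat.le_of_succ_le hi)
    set p := lowSlope G θ ((i + 1 : ℕ) * (G.D / n)) with hp
    have hz : (i : ℝ) * (G.D / n) ∈ Icc 0 G.D := by
      refine ⟨by positivity, ?_⟩
      calc (i : ℝ) * (G.D / n) ≤ n * (G.D / n) := by gcongr
        _ = G.D := hnD
    have hp0 : 0 ≤ p := le_max_left _ _
    have hps : p ≤ valueSlope G (i * (G.D / n)) := max_le (valueSlope_nonneg hy _) (hpart i hi)
    have hpr : p ≤ G.r := hps.trans (valueSlope_le_r hL _)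
    have hpL : opL G p ≤ G.h (i * (G.D / n)) := le_h_of_le_level hL hz hps
    -- Strictness comes from `θ > 0`: the velocity `p / (2c)` leaves a strictly negative total
    -- drift.
    have hplt : p < 2 * G.c * -G.y := by
      refine max_lt (by positivity) ?_
      linarith [valueSlope_le (G := G) ((i + 1 : ℕ) * (G.D / n))]
    have hdrift : 0 < -G.y - p / (2 * G.c) := by
      rw [sub_pos, div_lt_iff₀ (by positivity)]
      linarith
    have hD := G.D_pos
    -- Over the time `M` the drift alone would lower the state by `D + 1`, out of `[0,D]`, so the
    -- step ends by reaching the bottom of the cell.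
    obtain ⟨ζ₁, T₁, Δ, h₁, hTT, hΔ, hexit, htr, hpay⟩ := h.exists_step hα (p / (2 * G.c)) hz
      (M := (G.D + 1) / (-G.y - p / (2 * G.c))) (by positivity)
    have hm0 := h.traj_mem hα ⟨h.nonneg, le_rfl⟩
    have hm1 := h₁.traj_mem hα ⟨h₁.nonneg, le_rfl⟩
    have hle1 : traj G x α ζ₁ T₁ ≤ i * (G.D / n) := by
      refine hexit.resolve_right fun hT => ?_
      have e : (G.y + p / (2 * G.c)) * (T₁ - T) = -(G.D + 1) := by
        rw [hT, add_sub_cancel_left, show G.y + p / (2 * G.c) = -(-G.y - p / (2 * G.c)) by ring,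
          neg_mul, mul_div_cancel₀ _ hdrift.ne']
      linarith [hm0.2, hm1.1]
    obtain ⟨ζ₂, T₂, h₂, h20, hpay2⟩ := ih (Nat.le_of_succ_le hi) ζ₁ T₁ h₁ hle1
    refine ⟨ζ₂, T₂, h₂, h20, le_trans ?_ hpay2⟩
    have hdec : traj G x α ζ₁ T₁ ≤ traj G x α ζ T := by
      rw [htr]
      have : 0 ≤ (-G.y - p / (2 * G.c)) * (T₁ - T) := mul_nonneg hdrift.le (sub_nonneg.2 hTT)
      linarith
    have hW := lowInt_sub_le hL (θ := θ) hdec hle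
    rw [← hp] at hW
    have e1 : traj G x α ζ T - traj G x α ζ₁ T₁ = -(G.y + p / (2 * G.c)) * (T₁ - T) + Δ := by
      rw [htr]
      ring
    have e2 : p * -(G.y + p / (2 * G.c)) + G.c * (p / (2 * G.c)) ^ 2 = opL G p := by
      unfold opL
      field_simp
      ring
    have e3 : p * (traj G x α ζ T - traj G x α ζ₁ T₁)
        = (opL G p - G.c * (p / (2 * G.c)) ^ 2) * (T₁ - T) + p * Δ := by
      rw [e1, ← e2]
      ring
    have e4 := mul_le_mul_of_nonneg_right hpL (sub_nonneg.2 hTT)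
    have e5 := mul_le_mul_of_nonneg_right hpr hΔ
    linarith

lemma slopeInt_sub_le (hy : G.r / (4 * G.c) ≤ -G.y) {a b : ℝ} (hab : a ≤ b) :
    slopeInt G b - slopeInt G a ≤ G.r * (b - a) := by
  have := slopeInt_dist_le hy b a
  rw [Real.dist_eq, Real.dist_eq, abs_of_nonneg (sub_nonneg.2 hab)] at this
  exact (le_abs_self _).trans this

lemma potential_sub_le (hy : G.r / (4 * G.c) ≤ -G.y) {a b : ℝ} (hab : a ≤ b) :
    potential G b - potential G a ≤ G.r * (b - a) := by
  have h := slopeInt_sub_le hy (min_le_min_right G.level hab)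
  have e : ∀ z : ℝ, max (z - G.level) 0 = z - min z G.level := fun z => by
    rcases le_total z G.level with h | h
    · rw [min_eq_left h, max_eq_right (by linarith), sub_self]
    · rw [min_eq_right h, max_eq_left (by linarith)]
  rw [potential, potential, e, e]
  linarith

/-- The two errors are `θ z` from the reduced slope and `r δ` from stopping slightly above the
level. -/
lemma potential_le_lowInt (hy : G.r / (4 * G.c) ≤ -G.y) {θ δ z : ℝ} (hδ : 0 ≤ δ) (hz : 0 ≤ z)
    (hzl : z ≤ G.level + δ) : potential G z ≤ lowInt G θ z + θ * z + G.r * δ := by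
  have hL := opL_r_nonneg hy
  have h1 := slopeInt_le_lowInt hL (θ := θ) hz
  have hr := G.r_pos
  rcases le_total z G.level with h | h
  · rw [potential_of_le h]
    have : 0 ≤ G.r * δ := by positivity
    linarith
  · rw [potential_of_ge h]
    have h2 : G.r * (z - G.level) ≤ G.r * δ := by
      gcongr
      linarith
    have h3 : slopeInt G G.level ≤ slopeInt G z := by
      rw [← sub_nonneg, slopeInt_sub hL]
      exact intervalIntegral.integral_nonneg h fun t _ => valueSlope_nonneg hy t
    linarith

lemma isAlive_zero : IsAlive G x α Path.zero 0 :=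
  ⟨le_rfl, ⟨0, LipschitzWith.const 0⟩, fun _ ht => absurd ht.2 ht.1.not_gt⟩

lemma traj_zero : traj G x α Path.zero 0 = x - α (optimalPair G Path.zero) 0 := by
  rw [traj_eq]
  simp [Path.zero]

lemma payoff_zero : payoff G x α Path.zero 0 = G.r * α (optimalPair G Path.zero) 0 := by
  simp [payoff]

lemma rejection_nonneg (ϱ : Rejection) (t : ℝ) : 0 ≤ ϱ t := by
  rw [← ϱ.zero_of_neg' (min t 0 - 1) (by linarith [min_le_right t 0])]
  exact ϱ.mono' (by linarith [min_le_left t 0])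

/-- The initial phase of the maximizing player. -/
lemma exists_initial_phase (hy : G.r / (4 * G.c) ≤ -G.y) (hα : α ∈ admissible G x)
    (hx : x ∈ Icc 0 G.D) {δ : ℝ} (hδ : 0 < δ) :
    ∃ ζ T, IsAlive G x α ζ T ∧ (potential G x ≤ payoff G x α ζ T ∨
      traj G x α ζ T ≤ G.level + δ ∧
      potential G x - potential G (traj G x α ζ T) ≤ payoff G x α ζ T) := by
  have hL := opL_r_nonneg hy
  have hl := level_mem hL
  have hr := G.r_pos
  have hc := G.c_pos
  have hρ := rejection_nonneg (α (optimalPair G Path.zero)) 0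
  rcases le_or_gt x G.level with hxl | hxl
  · refine ⟨Path.zero, 0, isAlive_zero, Or.inr ⟨?_, ?_⟩⟩
    · rw [traj_zero]
      linarith
    · rw [traj_zero, payoff_zero]
      refine (potential_sub_le hy (by linarith)).trans_eq ?_
      ring
  · obtain ⟨z, hz1, hz2⟩ := exists_between (lt_min hxl (show G.level < G.level + δ by linarith))
    have hzx := hz2.trans_le (min_le_left _ _)
    have hzδ := hz2.trans_le (min_le_right _ _)
    have hzD : z ∈ Icc 0 G.D := ⟨hl.1.trans hz1.le, hzx.le.trans hx.2⟩
    have hgain := sub_pos.2 (opL_lt_h hL hz1 hzD.2)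
    have hD := G.D_pos
    -- The velocity `r / (2c)` need not push the state down. But staying above `z` earns `h z - opL
    -- G G.r > 0` per unit time beyond the potential, and after the time `M` this surplus is `r D`,
    -- enough to cover `potential G x`.
    obtain ⟨ζ, T, Δ, h, hT, hΔ, hexit, htr, hpay⟩ := isAlive_zero.exists_step hα
      (G.r / (2 * G.c)) hzD (M := G.r * G.D / (G.h z - opL G G.r)) (by positivity)
    rw [sub_zero] at htr hpay
    have e1 : G.r * (G.y + G.r / (2 * G.c)) - G.c * (G.r / (2 * G.c)) ^ 2 = -opL G G.r := by
      unfold opL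
      field_simp
      ring
    have e2 : G.r * (x - traj G x α ζ T) + (G.h z - opL G G.r) * T ≤ payoff G x α ζ T := by
      refine le_trans (le_of_eq ?_) hpay
      rw [htr, traj_zero, payoff_zero, sub_eq_add_neg (G.h z), ← e1]
      ring
    have hmem := h.traj_mem hα ⟨h.nonneg, le_rfl⟩
    refine ⟨ζ, T, h, ?_⟩
    rcases hexit with hs | hs
    · refine Or.inr ⟨hs.trans hzδ.le, ?_⟩
      have h1 := potential_sub_le hy (hs.trans hzx.le)
      have h2 : 0 ≤ (G.h z - opL G G.r) * T := mul_nonneg hgain.le hT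
      linarith
    · left
      have h1 := potential_sub_le hy hx.1
      rw [potential_zero hL] at h1
      have h2 : (G.h z - opL G G.r) * T = G.r * G.D := by
        rw [hs, zero_add, mul_div_cancel₀ _ hgain.ne']
      have h3 := mul_le_mul_of_nonneg_left hmem.2 hr.le
      linarith

theorem potential_le_value (hy : G.r / (4 * G.c) ≤ -G.y) (hx : x ∈ Icc 0 G.D) :
    (potential G x : EReal) ≤ value G x := by
  refine le_iInf₂ fun α hα => ?_
  have hr := G.r_pos
  have hD := G.D_pos
  have key : ∀ ε > 0, ((potential G x - ε : ℝ) : EReal)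
      ≤ ⨆ ψ ∈ hittingControls G x α, cost G x ψ (α ψ) := by
    intro ε hε
    -- `δ` and `θ` are chosen so that the errors `r δ` and `θ D` are each `ε / 2`.
    obtain ⟨ζ, T, h, hcase⟩ := exists_initial_phase hy hα hx (δ := ε / (2 * G.r)) (by positivity)
    obtain ⟨ζ', T', h', h0, hpay⟩ := h.exists_finish hy hα (θ := ε / (2 * G.D)) (by positivity)
    refine le_trans (EReal.coe_le_coe_iff.2 ?_) (h'.payoff_le h0)
    have hmem := h.traj_mem hα ⟨h.nonneg, le_rfl⟩
    rcases hcase with hb | ⟨hb, hc⟩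
    · linarith [lowInt_nonneg (G := G) (θ := ε / (2 * G.D)) hmem.1]
    · have h1 := potential_le_lowInt hy (θ := ε / (2 * G.D)) (δ := ε / (2 * G.r))
        (by positivity) hmem.1 hb
      have h2 : ε / (2 * G.D) * traj G x α ζ T ≤ ε / (2 * G.D) * G.D := by
        gcongr
        exact hmem.2
      have h3 : ε / (2 * G.D) * G.D = ε / 2 := by field_simp
      have h4 : G.r * (ε / (2 * G.r)) = ε / 2 := by field_simp
      linarith
  refine le_of_forall_lt fun c hcx => ?_
  obtain ⟨q, hcq, hq⟩ := EReal.lt_iff_exists_real_btwn.1 hcx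
  refine hcq.trans_le ?_
  have := key (potential G x - q) (sub_pos.2 (EReal.coe_lt_coe_iff.1 hq))
  rwa [sub_sub_cancel] at this

theorem value_eq_potential (hy : G.r / (4 * G.c) ≤ -G.y) (hx : x ∈ Icc 0 G.D) :
    value G x = (potential G x : EReal) :=
  le_antisymm (value_le_potential hy hx) (potential_le_value hy hx)

end lowerBound

end HittingGame

end

theorem mainTheorem3 (G : HittingGame.Data) (hy : G.r / (4 * G.c) ≤ -G.y) :
    (∀ x ∈ Set.Icc 0 G.D, HittingGame.value G x ≠ ⊤ ∧ HittingGame.value G x ≠ ⊥) ∧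
    HittingGame.IsViscositySolution G (fun x => (HittingGame.value G x).toReal) ∧
    ∀ f : ℝ → ℝ, HittingGame.IsViscositySolution G f →
      ∀ x ∈ Set.Icc 0 G.D, (f x : EReal) = HittingGame.value G x := by
  have hL := HittingGame.opL_r_nonneg hy
  refine ⟨fun x hx => ?_, ?_, fun f hf x hx => ?_⟩
  · rw [HittingGame.value_eq_potential hy hx]
    exact ⟨EReal.coe_ne_top _, EReal.coe_ne_bot _⟩
  · refine (HittingGame.potential_isViscositySolution hL).congr fun x hx => ?_
    rw [HittingGame.value_eq_potential hy hx, EReal.toReal_coe]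
  · rw [HittingGame.value_eq_potential hy hx, HittingGame.viscositySolution_unique hL hf hx]
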